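/- For each $n$, let the edges of the complete graph on $n$ vertices carry i.i.d. weights with the exponential distribution of mean $1$. We consider both the complete directed graph (one weight for each ordered pair of distinct vertices; cycles are directed cycles through $k\ge 2$ distinct vertices) and the complete undirected graph (one weight for each unordered pair of distinct vertices; cycles pass through $k\ge 3$ distinct vertices). The mean weight of a cycle is the sum of its edge weights divided by the number of its edges. Let $T(z)=\sum_{k=1}^\infty k^{k-1}z^k/k!$ be the tree function; the series converges for $|z|\le 1/e$. Let $c\ge 0$ be fixed. For the complete directed graph, $$\lim_{n\to\infty}\Pr[\exists\text{ cycle with mean weight}\le c/n]=F_{\mathrm{dir}}(c):=\begin{cases}1-\exp[-T(c)+c] & c\le 1/e,\\ 1 & c>1/e,\end{cases}$$ and for the complete undirected graph, $$\lim_{n\to\infty}\Pr[\exists\text{ cycle with mean weight}\le c/n]=F_{\mathrm{und}}(c):=\begin{cases}1-\exp[(-T(c)+c+c^2)/2] & c\le 1/e,\\ 1 & c>1/e.\end{cases}$$ In particular each of $F=F_{\mathrm{dir}},F_{\mathrm{und}}$ jumps at $c=1/e$: its left limit there is $F(1/e)<1$, and its right limit there is $1$. -/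

import Mathlib

open MeasureTheory ProbabilityTheory Filter Topology

namespace MinMeanCycle

noncomputable section

/-- The tree function `T(z) = ∑_{k ≥ 1} k^(k-1) z^k / k!`; the summation index is shifted by one. -/
def treeFunction (z : ℝ) : ℝ :=
  ∑' k : ℕ, ((k + 1 : ℕ) : ℝ) ^ k * z ^ (k + 1) / ((k + 1).factorial : ℝ)

/-- The series defining the tree function converges for `|z| ≤ 1/e`. -/
theorem summable_treeFunction {z : ℝ} (hz : |z| ≤ 1 / Real.exp 1) :
    Summable fun k : ℕ => ((k + 1 : ℕ) : ℝ) ^ k * z ^ (k + 1) / ((k + 1).factorial : ℝ) := by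
  have hs : Summable fun k : ℕ => 1 / (((k + 1 : ℕ) : ℝ) ^ (3 / 2 : ℝ)) :=
    (summable_nat_add_iff 1).2 (Real.summable_one_div_nat_rpow.2 (by norm_num))
  refine Summable.of_norm_bounded hs fun k => ?_
  have hm : (0 : ℝ) < ((k + 1 : ℕ) : ℝ) := by positivity
  have hst := Stirling.le_factorial_stirling (k + 1)
  set m : ℝ := ((k + 1 : ℕ) : ℝ) with hmdef
  have he := Real.exp_pos 1
  have hsq : √m ≤ √(2 * Real.pi * m) := by
    apply Real.sqrt_le_sqrt
    nlinarith [Real.pi_gt_three]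
  have hf : √m * (m / Real.exp 1) ^ (k + 1) ≤ ((k + 1).factorial : ℝ) :=
    (mul_le_mul_of_nonneg_right hsq (by positivity)).trans hst
  have hpow : m ^ (3 / 2 : ℝ) = m * √m := by
    rw [Real.sqrt_eq_rpow, ← Real.rpow_one_add' hm.le (by norm_num)]
    norm_num
  rw [norm_div, norm_mul, norm_pow, norm_pow, Real.norm_eq_abs, Real.norm_eq_abs, Real.norm_eq_abs,
    abs_of_pos hm, abs_of_nonneg (by positivity : (0 : ℝ) ≤ ((k + 1).factorial : ℝ)), hpow]
  have hzp : |z| ^ (k + 1) ≤ (1 / Real.exp 1) ^ (k + 1) :=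
    pow_le_pow_left₀ (abs_nonneg z) hz _
  rw [div_le_div_iff₀ (by positivity) (by positivity), one_mul]
  calc m ^ k * |z| ^ (k + 1) * (m * √m)
      ≤ m ^ k * (1 / Real.exp 1) ^ (k + 1) * (m * √m) := by gcongr
    _ = √m * (m / Real.exp 1) ^ (k + 1) := by
        rw [div_pow, div_pow, one_pow, pow_succ m k]; ring
    _ ≤ _ := hf

/-- The family `W` of real random variables is i.i.d. with the exponential law of mean `1`. -/
def IsIIDExp {Ω ι : Type*} [MeasurableSpace Ω] (P : Measure Ω) (W : ι → Ω → ℝ) : Prop :=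
  (∀ e, HasLaw (W e) (expMeasure 1) P) ∧ iIndepFun W P

/-! ### Directed graphs -/

/-- The arcs of the complete directed graph on `V`: ordered pairs of distinct vertices. -/
abbrev Arc (V : Type*) : Type _ := {a : V × V // a.1 ≠ a.2}

/-- A directed cycle of length `k ≥ 2` in the complete directed graph on `V`, given by its
pairwise distinct vertices `v₀ → v₁ → ⋯ → v_{k-1} → v₀` (with a chosen starting vertex). -/
structure DirectedCycle (V : Type*) (k : ℕ) where
  two_le : 2 ≤ k
  vertex : Fin k → V
  injective : Function.Injective vertex

theorem finRotate_ne_self {k : ℕ} (hk : 2 ≤ k) (i : Fin k) : finRotate k i ≠ i := by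
  obtain ⟨m, rfl⟩ := Nat.exists_eq_add_of_le' hk
  have h : i ∈ (finRotate (m + 2)).support := by rw [support_finRotate]; exact Finset.mem_univ i
  exact Equiv.Perm.mem_support.1 h

/-- The `i`-th arc `vᵢ → vᵢ₊₁` of a directed cycle, the index `i + 1` being taken modulo `k`. -/
def DirectedCycle.arc {V : Type*} {k : ℕ} (C : DirectedCycle V k) (i : Fin k) : Arc V :=
  ⟨(C.vertex i, C.vertex (finRotate k i)), fun h =>
    finRotate_ne_self C.two_le i (C.injective h).symm⟩

/-- The mean weight of a directed cycle: total weight of its arcs divided by its length. -/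
def DirectedCycle.meanWeight {V : Type*} {k : ℕ} (C : DirectedCycle V k) (w : Arc V → ℝ) : ℝ :=
  (∑ i, w (C.arc i)) / k

/-- The weighted complete directed graph has a directed cycle of mean weight at most `x`. -/
def HasLightDirectedCycle {V : Type*} (w : Arc V → ℝ) (x : ℝ) : Prop :=
  ∃ (k : ℕ) (C : DirectedCycle V k), C.meanWeight w ≤ x

/-! ### Undirected graphs -/

/-- The edges of the complete undirected graph on `V`. -/
abbrev Edge (V : Type*) : Type _ := (⊤ : SimpleGraph V).edgeSet

/-- The mean weight of a walk: total weight of its edges divided by its length. -/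
def walkMeanWeight {V : Type*} (w : Edge V → ℝ) {u v : V} (p : (⊤ : SimpleGraph V).Walk u v) : ℝ :=
  (p.edges.attach.map fun e => w ⟨e.1, p.edges_subset_edgeSet e.2⟩).sum / p.length

/-- The weighted complete undirected graph has a cycle of mean weight at most `x`. -/
def HasLightCycle {V : Type*} (w : Edge V → ℝ) (x : ℝ) : Prop :=
  ∃ (u : V) (p : (⊤ : SimpleGraph V).Walk u u), p.IsCycle ∧ walkMeanWeight w p ≤ x

/-! ### The limiting distribution functions (for `c ≥ 0`) -/

def directedLimit (c : ℝ) : ℝ :=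
  if c ≤ 1 / Real.exp 1 then 1 - Real.exp (-treeFunction c + c) else 1

def undirectedLimit (c : ℝ) : ℝ :=
  if c ≤ 1 / Real.exp 1 then 1 - Real.exp ((-treeFunction c + c + c ^ 2) / 2) else 1

/-- `F` jumps at `a` from the value `F a < 1`, which is its left limit, to the right limit `1`. -/
def JumpsToOneAt (F : ℝ → ℝ) (a : ℝ) : Prop :=
  F a < 1 ∧ Tendsto F (𝓝[<] a) (𝓝 (F a)) ∧ Tendsto F (𝓝[>] a) (𝓝 1)

end

end MinMeanCycle

namespace MinMeanCycle

/-! ### Poisson approximation for the probability that no event occurs -/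

/-- A bounded solution of the Stein equation for the Poisson law and the set `{0}`. -/
theorem exists_stein_solution (l : ℝ) (hl : 0 ≤ l) :
    ∃ f : ℕ → ℝ, (∀ w, 0 ≤ f w ∧ f w ≤ 1) ∧
      ∀ w : ℕ, l * f (w + 1) - w * f w = (if w = 0 then 1 else 0) - Real.exp (-l) := by
  have hc : ∀ m : ℕ, Continuous fun t : ℝ => t ^ m * Real.exp (-(l * t)) := fun m => by fun_prop
  refine ⟨fun w => ∫ t in (0 : ℝ)..1, t ^ (w - 1) * Real.exp (-(l * t)), fun w => ⟨?_, ?_⟩,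
    fun w => ?_⟩
  · exact intervalIntegral.integral_nonneg zero_le_one fun t ht =>
      mul_nonneg (pow_nonneg ht.1 _) (Real.exp_pos _).le
  · have h := intervalIntegral.integral_mono_on (a := 0) (b := 1) (μ := volume) zero_le_one
      ((hc (w - 1)).intervalIntegrable 0 1) (intervalIntegrable_const (c := (1 : ℝ)))
      fun t ht => by
        have h1 : t ^ (w - 1) ≤ 1 := pow_le_one₀ ht.1 ht.2
        have h2 : Real.exp (-(l * t)) ≤ 1 :=
          Real.exp_le_one_iff.2 (by have := mul_nonneg hl ht.1; linarith)
        exact mul_le_one₀ h1 (Real.exp_pos _).le h2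
    simpa using h
  · have hd : ∀ t ∈ Set.uIcc (0 : ℝ) 1, HasDerivAt (fun t : ℝ => t ^ w * Real.exp (-(l * t)))
        (w * (t ^ (w - 1) * Real.exp (-(l * t))) - l * (t ^ w * Real.exp (-(l * t)))) t := by
      intro t _
      have he : HasDerivAt (fun t : ℝ => Real.exp (-(l * t)))
          (Real.exp (-(l * t)) * (-(l * 1))) t :=
        (((hasDerivAt_id' t).const_mul l).fun_neg).exp
      refine ((hasDerivAt_pow w t).fun_mul he).congr_deriv ?_
      ring
    have hi1 := ((hc (w - 1)).const_mul (w : ℝ)).intervalIntegrable (μ := volume) 0 1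
    have hi2 := ((hc w).const_mul l).intervalIntegrable (μ := volume) 0 1
    have h := intervalIntegral.integral_eq_sub_of_hasDerivAt hd (hi1.sub hi2)
    rw [intervalIntegral.integral_sub hi1 hi2, intervalIntegral.integral_const_mul,
      intervalIntegral.integral_const_mul] at h
    simp only [Nat.add_sub_cancel]
    have h0 : (0 : ℝ) ^ w = if w = 0 then 1 else 0 := by
      split_ifs with hw
      · simp [hw]
      · simp [hw]
    rw [h0] at h
    simp only [one_pow, mul_one, one_mul, mul_zero, neg_zero, Real.exp_zero] at h
    linarith

section ChenStein

variable {Ω ι : Type*}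

open Classical in
/-- The number of those events `A a` with `a ∈ s` that occur. -/
noncomputable def eventCount (A : ι → Set Ω) (s : Finset ι) (ω : Ω) : ℕ :=
  ∑ a ∈ s, if ω ∈ A a then 1 else 0

theorem measurable_eventCount [MeasurableSpace Ω] {A : ι → Set Ω}
    (hA : ∀ a, MeasurableSet (A a)) (s : Finset ι) :
    Measurable (eventCount A s) :=
  Finset.measurable_fun_sum s fun a _ => Measurable.ite (hA a) measurable_const measurable_const

theorem eventCount_univ_eq_zero_iff [Fintype ι] (A : ι → Set Ω) (ω : Ω) :
    eventCount A Finset.univ ω = 0 ↔ ∀ a, ω ∉ A a := by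
  simp [eventCount]

/-- Chen–Stein bound for the probability that none of the events `A a` occurs, where `A a` is
independent of the number of the events outside its dependency neighbourhood `D a`. -/
theorem abs_measure_forall_notMem_sub_exp_le [MeasurableSpace Ω] [Fintype ι]
    (μ : Measure Ω) [IsProbabilityMeasure μ]
    (A : ι → Set Ω) (hA : ∀ a, MeasurableSet (A a)) [DecidableEq ι] (D : ι → Finset ι)
    (hD : ∀ a, a ∈ D a)
    (hind : ∀ a, IndepFun ((A a).indicator fun _ => (1 : ℝ)) (eventCount A (D a)ᶜ) μ) :
    |μ.real {ω | ∀ a, ω ∉ A a} - Real.exp (-∑ a, μ.real (A a))| ≤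
      ∑ a, ∑ b ∈ D a, μ.real (A a) * μ.real (A b) +
        ∑ a, ∑ b ∈ (D a).erase a, μ.real (A a ∩ A b) := by
  classical
  set l := ∑ a, μ.real (A a) with hl
  obtain ⟨f, hf, hfs⟩ := exists_stein_solution l (Finset.sum_nonneg fun a _ => measureReal_nonneg)
  set N := eventCount A Finset.univ with hN
  have hNm : Measurable N := measurable_eventCount hA _
  let I : ι → Ω → ℝ := fun a => (A a).indicator fun _ => 1
  have hIm : ∀ a, Measurable (I a) := fun a => measurable_const.indicator (hA a)
  have hI01 : ∀ a ω, I a ω = if ω ∈ A a then 1 else 0 := fun a ω => by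
    simp [I, Set.indicator_apply]
  have hIint : ∀ a, Integrable (I a) μ := fun a => (integrable_const 1).indicator (hA a)
  have hIE : ∀ a, ∫ ω, I a ω ∂μ = μ.real (A a) := fun a => by
    simp [I, integral_indicator (hA a)]
  have hfint : ∀ (g : Ω → ℕ), Measurable g → Integrable (fun ω => f (g ω)) μ := fun g hg =>
    Integrable.of_bound ((measurable_from_nat (f := f)).comp hg).aestronglyMeasurable 1
      (Eventually.of_forall fun ω => by
        rw [Real.norm_eq_abs, abs_of_nonneg (hf _).1]; exact (hf _).2)
  have hIf : ∀ (a : ι) (g : Ω → ℕ), Measurable g → Integrable (fun ω => I a ω * f (g ω)) μ :=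
    fun a g hg => Integrable.of_bound
      ((hIm a).mul ((measurable_from_nat (f := f)).comp hg)).aestronglyMeasurable 1
      (Eventually.of_forall fun ω => by
        rw [Real.norm_eq_abs, abs_mul, abs_of_nonneg (hf _).1, hI01]
        split_ifs
        · simpa using (hf _).2
        · simp)
  let M : ι → Ω → ℕ := fun a => eventCount A (D a)ᶜ
  have hMm : ∀ a, Measurable (M a) := fun a => measurable_eventCount hA _
  have hsplit : ∀ a ω, N ω = M a ω + eventCount A (D a) ω := fun a ω => by
    simp only [hN, M, eventCount]
    rw [add_comm, Finset.sum_add_sum_compl]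
  -- the expectation of the Stein equation
  have hstein : μ.real {ω | ∀ a, ω ∉ A a} - Real.exp (-l) =
      ∑ a, ∫ ω, (μ.real (A a) * f (N ω + 1) - I a ω * f (N ω)) ∂μ := by
    have hi : ∀ a ∈ Finset.univ,
        Integrable (fun ω => μ.real (A a) * f (N ω + 1) - I a ω * f (N ω)) μ := fun a _ =>
      ((hfint _ (hNm.add_const 1)).const_mul _).sub (hIf a _ hNm)
    rw [← integral_finsetSum _ hi]
    have hset : MeasurableSet {ω | N ω = 0} := hNm (measurableSet_singleton 0)
    have heq : {ω | ∀ a, ω ∉ A a} = {ω | N ω = 0} := by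
      ext ω; exact (eventCount_univ_eq_zero_iff A ω).symm
    have hpt : ∀ ω, ∑ a, (μ.real (A a) * f (N ω + 1) - I a ω * f (N ω)) =
        ({ω | N ω = 0}.indicator (fun _ => (1 : ℝ)) ω) - Real.exp (-l) := fun ω => by
      rw [Finset.sum_sub_distrib, ← Finset.sum_mul, ← Finset.sum_mul]
      have hNs : ∑ a, I a ω = (N ω : ℝ) := by simp [hN, eventCount, hI01]
      rw [hNs, ← hl, hfs]
      simp [Set.indicator_apply]
    simp_rw [hpt]
    rw [integral_sub ((integrable_const 1).indicator hset) (integrable_const _),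
      integral_indicator hset, heq]
    simp
  rw [hstein, ← Finset.sum_add_distrib]
  refine (Finset.abs_sum_le_sum_abs _ _).trans (Finset.sum_le_sum fun a _ => ?_)
  have hindep : ∫ ω, I a ω * f (M a ω + 1) ∂μ = μ.real (A a) * ∫ ω, f (M a ω + 1) ∂μ := by
    have h : IndepFun (I a) (fun ω => f (M a ω + 1)) μ :=
      (hind a).comp (φ := id) (ψ := fun m => f (m + 1)) measurable_id measurable_from_nat
    rw [← hIE]
    exact h.integral_fun_mul_eq_mul_integral (hIm a).aestronglyMeasurable
      ((measurable_from_nat (f := fun m => f (m + 1))).comp (hMm a)).aestronglyMeasurable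
  have hrew : ∫ ω, (μ.real (A a) * f (N ω + 1) - I a ω * f (N ω)) ∂μ =
      ∫ ω, (μ.real (A a) * (f (N ω + 1) - f (M a ω + 1)) -
        (I a ω * f (N ω) - I a ω * f (M a ω + 1))) ∂μ := by
    have i1 := hfint _ (hNm.add_const 1)
    have i2 := hfint _ ((hMm a).add_const 1)
    have i3 := hIf a _ hNm
    have i4 := hIf a _ ((hMm a).add_const 1)
    have i12 : Integrable (fun ω => μ.real (A a) * (f (N ω + 1) - f (M a ω + 1))) μ :=
      (i1.sub i2).const_mul _
    have i34 : Integrable (fun ω => I a ω * f (N ω) - I a ω * f (M a ω + 1)) μ := i3.sub i4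
    rw [integral_sub (i1.const_mul _) i3, integral_sub i12 i34,
      integral_const_mul, integral_const_mul, integral_sub i1 i2, integral_sub i3 i4, hindep]
    ring
  have hrhs : ∑ b ∈ D a, μ.real (A a) * μ.real (A b) +
      ∑ b ∈ (D a).erase a, μ.real (A a ∩ A b) =
      ∫ ω, (∑ b ∈ D a, μ.real (A a) * I b ω +
        ∑ b ∈ (D a).erase a, (A a ∩ A b).indicator (fun _ => (1 : ℝ)) ω) ∂μ := by
    have hAB : ∀ b, Integrable ((A a ∩ A b).indicator fun _ => (1 : ℝ)) μ := fun b =>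
      (integrable_const 1).indicator ((hA a).inter (hA b))
    rw [integral_add (integrable_finsetSum _ fun b _ => (hIint b).const_mul _)
      (integrable_finsetSum _ fun b _ => hAB b),
      integral_finsetSum _ (fun b _ => (hIint b).const_mul _),
      integral_finsetSum _ (fun b _ => hAB b)]
    congr 1
    · exact Finset.sum_congr rfl fun b _ => by rw [integral_const_mul, hIE]
    · exact Finset.sum_congr rfl fun b _ => by
        rw [integral_indicator ((hA a).inter (hA b))]; simp
  rw [hrew, hrhs]
  refine abs_integral_le_integral_abs.trans (integral_mono_of_nonneg
    (Eventually.of_forall fun ω => abs_nonneg _) ?_ (Eventually.of_forall fun ω => ?_))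
  · exact (integrable_finsetSum _ fun b _ => (hIint b).const_mul _).add
      (integrable_finsetSum _ fun b _ =>
        (integrable_const 1).indicator ((hA a).inter (hA b)))
  have hdiff : ∀ m n : ℕ, |f m - f n| ≤ 1 := fun m n =>
    abs_sub_le_iff.2 ⟨by linarith [(hf m).2, (hf n).1], by linarith [(hf n).2, (hf m).1]⟩
  have hp0 : 0 ≤ μ.real (A a) := measureReal_nonneg
  have hI0 : ∀ b, 0 ≤ I b ω := fun b => by rw [hI01]; split_ifs <;> norm_num
  refine (abs_sub _ _).trans (add_le_add ?_ ?_)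
  · rw [abs_mul, abs_of_nonneg hp0, ← Finset.mul_sum]
    refine mul_le_mul_of_nonneg_left ?_ hp0
    by_cases h : ∃ b ∈ D a, ω ∈ A b
    · obtain ⟨b, hb, hωb⟩ := h
      refine (hdiff _ _).trans (le_trans ?_ (Finset.single_le_sum (fun b _ => hI0 b) hb))
      rw [hI01, if_pos hωb]
    · push Not at h
      have h0 : eventCount A (D a) ω = 0 := Finset.sum_eq_zero fun b hb => by simp [h b hb]
      rw [hsplit a, h0]
      simpa using Finset.sum_nonneg fun b _ => hI0 b
  · have hnn : ∀ b ∈ (D a).erase a, 0 ≤ (A a ∩ A b).indicator (fun _ => (1 : ℝ)) ω :=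
      fun b _ => Set.indicator_nonneg (fun _ _ => zero_le_one) _
    by_cases ha : ω ∈ A a
    · have hIa : I a ω = 1 := by rw [hI01, if_pos ha]
      rw [hIa, one_mul, one_mul]
      by_cases h : ∃ b ∈ (D a).erase a, ω ∈ A b
      · obtain ⟨b, hb, hωb⟩ := h
        refine (hdiff _ _).trans (le_trans ?_ (Finset.single_le_sum hnn hb))
        rw [Set.indicator_of_mem (show ω ∈ A a ∩ A b from ⟨ha, hωb⟩)]
      · push Not at h
        have h1 : eventCount A (D a) ω = 1 := by
          rw [eventCount, ← Finset.add_sum_erase _ _ (hD a), if_pos ha,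
            Finset.sum_eq_zero fun b hb => by simp [h b hb], add_zero]
        rw [hsplit a, h1]
        simpa using Finset.sum_nonneg hnn
    · have hIa : I a ω = 0 := by rw [hI01, if_neg ha]
      simpa [hIa] using Finset.sum_nonneg hnn

end ChenStein

/-! ### Sums of independent exponential variables -/

instance : IsProbabilityMeasure (expMeasure 1) := isProbabilityMeasure_expMeasure one_pos

theorem expMeasure_Iic_le {q : ℝ} (hq : 0 ≤ q) : expMeasure 1 (Set.Iic q) ≤ ENNReal.ofReal q := by
  have h : (expMeasure 1).real (Set.Iic q) ≤ q := by
    rw [← cdf_eq_real, cdf_expMeasure_eq one_pos, if_pos hq]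
    have := Real.add_one_le_exp (-(1 * q))
    linarith
  rw [← ofReal_measureReal]
  exact ENNReal.ofReal_le_ofReal h

theorem ae_nonneg_expMeasure : ∀ᵐ x ∂expMeasure 1, 0 ≤ x := by
  have h : expMeasure 1 (Set.Iio 0) = 0 := by
    rw [expMeasure, gammaMeasure, withDensity_apply _ measurableSet_Iio]
    exact lintegral_exponentialPDF_of_nonpos le_rfl
  rw [ae_iff]
  simpa [Set.Iio] using h

/-- The distribution function of `ν` has the behaviour at `0` of that of a sum of `k` independent
exponential variables. -/
structure ErlangBounds (k : ℕ) (ν : Measure ℝ) : Prop where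
  of_neg : ∀ x < 0, ν (Set.Iic x) = 0
  le : ∀ x, 0 ≤ x → ν (Set.Iic x) ≤ ENNReal.ofReal (x ^ k / k.factorial)
  ge : ∀ x, 0 ≤ x → ENNReal.ofReal (Real.exp (-x) * (x ^ k / k.factorial)) ≤ ν (Set.Iic x)

theorem lintegral_Icc_sub_pow_div_factorial (k : ℕ) {a x : ℝ} (ha : 0 ≤ a) (hx : 0 ≤ x) :
    ∫⁻ t in Set.Icc 0 x, ENNReal.ofReal (a * ((x - t) ^ k / k.factorial)) =
      ENNReal.ofReal (a * (x ^ (k + 1) / (k + 1).factorial)) := by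
  rw [← ofReal_integral_eq_lintegral_ofReal]
  · congr 1
    rw [integral_Icc_eq_integral_Ioc, ← intervalIntegral.integral_of_le hx,
      intervalIntegral.integral_const_mul, intervalIntegral.integral_div,
      intervalIntegral.integral_comp_sub_left (fun t => t ^ k), integral_pow]
    rw [Nat.factorial_succ]
    push_cast
    simp only [sub_self, sub_zero, ne_eq, Nat.add_eq_zero_iff, one_ne_zero, and_false,
      not_false_eq_true, zero_pow]
    rw [div_div]
  · exact (by fun_prop : Continuous fun t : ℝ =>
      a * ((x - t) ^ k / k.factorial)).continuousOn.integrableOn_Icc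
  · refine (ae_restrict_iff' measurableSet_Icc).2 (Eventually.of_forall fun t ht => ?_)
    have : 0 ≤ x - t := sub_nonneg.2 ht.2
    simp only [Pi.zero_apply]
    positivity

theorem ErlangBounds.conv {k : ℕ} {ν : Measure ℝ} [SFinite ν] (h : ErlangBounds k ν) :
    ErlangBounds (k + 1) (expMeasure 1 ∗ ν) := by
  have hconv : ∀ x, (expMeasure 1 ∗ ν) (Set.Iic x) =
      ∫⁻ t in Set.Icc 0 x, ENNReal.ofReal (Real.exp (-t)) * ν (Set.Iic (x - t)) := by
    intro x
    have hm : Measurable fun t => ν (Set.Iic (x - t)) :=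
      Antitone.measurable fun s t hst => measure_mono (Set.Iic_subset_Iic.2 (by linarith))
    have h1 : (expMeasure 1 ∗ ν) (Set.Iic x) = ∫⁻ t, ν (Set.Iic (x - t)) ∂expMeasure 1 := by
      rw [← lintegral_indicator_one measurableSet_Iic,
        Measure.lintegral_conv (measurable_one.indicator measurableSet_Iic)]
      refine lintegral_congr fun t => ?_
      rw [← lintegral_indicator_one measurableSet_Iic]
      refine lintegral_congr fun y => ?_
      simp only [Set.indicator_apply, Set.mem_Iic, le_sub_iff_add_le, add_comm t y, Pi.one_apply]
    rw [h1, expMeasure, gammaMeasure, lintegral_withDensity_eq_lintegral_mul _ (by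
      exact (measurable_gammaPDFReal 1 1).ennreal_ofReal) hm,
      ← lintegral_indicator measurableSet_Icc]
    refine lintegral_congr fun t => ?_
    change exponentialPDF 1 t * ν (Set.Iic (x - t)) = _
    by_cases ht : t ∈ Set.Icc 0 x
    · rw [Set.indicator_of_mem ht, exponentialPDF_of_nonneg ht.1]
      simp
    · rw [Set.indicator_of_notMem ht]
      rcases lt_or_ge t 0 with h0 | h0
      · rw [exponentialPDF_of_neg h0, zero_mul]
      · rw [h.of_neg _ (by
          by_contra hc
          exact ht ⟨h0, by linarith⟩), mul_zero]
  refine ⟨fun x hx => ?_, fun x hx => ?_, fun x hx => ?_⟩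
  · rw [hconv, Set.Icc_eq_empty (not_le.2 hx)]
    simp
  · rw [hconv]
    have hJ := lintegral_Icc_sub_pow_div_factorial k zero_le_one hx
    simp only [one_mul] at hJ
    rw [← hJ]
    refine setLIntegral_mono' measurableSet_Icc fun t ht => ?_
    refine (mul_le_mul' (ENNReal.ofReal_le_one.2 (Real.exp_le_one_iff.2 ?_))
      (h.le _ (sub_nonneg.2 ht.2))).trans_eq (one_mul _)
    linarith [ht.1]
  · rw [hconv, ← lintegral_Icc_sub_pow_div_factorial k (Real.exp_pos _).le hx]
    refine setLIntegral_mono' measurableSet_Icc fun t ht => ?_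
    refine le_trans (le_of_eq ?_) (mul_le_mul_right (h.ge _ (sub_nonneg.2 ht.2)) _)
    rw [← ENNReal.ofReal_mul (Real.exp_pos _).le, ← mul_assoc, ← Real.exp_add]
    congr 3
    ring_nf

theorem erlangBounds_dirac : ErlangBounds 0 (Measure.dirac 0) := by
  refine ⟨fun x hx => ?_, fun x hx => ?_, fun x hx => ?_⟩
  · simp [hx]
  · simp [hx]
  · simp [hx]

section Product

theorem measurableSet_sum_le {E : Type*} (S : Finset E) (x : ℝ) :
    MeasurableSet {w : E → ℝ | ∑ e ∈ S, w e ≤ x} :=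
  measurableSet_le (by fun_prop) measurable_const

variable {E : Type*} [Fintype E]

/-- The law of independent exponential edge weights of mean `1`. -/
noncomputable def expWeights (E : Type*) [Fintype E] : Measure (E → ℝ) :=
  Measure.pi fun _ => expMeasure 1

instance : IsProbabilityMeasure (expWeights E) := by unfold expWeights; infer_instance

theorem iIndepFun_expWeights : iIndepFun (fun (e : E) (w : E → ℝ) => w e) (expWeights E) :=
  iIndepFun_pi (X := fun _ : E => (id : ℝ → ℝ)) fun _ => aemeasurable_id

theorem map_eval_expWeights (e : E) : (expWeights E).map (fun w => w e) = expMeasure 1 :=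
  (measurePreserving_eval (fun _ : E => expMeasure 1) e).map_eq

theorem erlangBounds_sum (S : Finset E) :
    ErlangBounds S.card ((expWeights E).map fun w => ∑ e ∈ S, w e) := by
  classical
  induction S using Finset.induction_on with
  | empty => simpa using erlangBounds_dirac
  | insert e S he ih =>
    have hi : IndepFun (∑ e ∈ S, fun w : E → ℝ => w e) (fun w => w e) (expWeights E) :=
      iIndepFun_expWeights.indepFun_finsetSum_of_notMem (fun e => measurable_pi_apply e) he
    have hS : (∑ e ∈ S, fun w : E → ℝ => w e) = fun w => ∑ e ∈ S, w e := by
      ext w; simp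
    rw [hS] at hi
    have hm : Measurable fun w : E → ℝ => ∑ e ∈ S, w e := by fun_prop
    have h := hi.symm.map_add_eq_map_conv_map (measurable_pi_apply e) hm
    rw [map_eval_expWeights] at h
    rw [Finset.card_insert_of_notMem he]
    have h2 : (fun w : E → ℝ => ∑ e' ∈ insert e S, w e') =
        (fun w => w e) + fun w => ∑ e' ∈ S, w e' := by
      ext w; simp [Finset.sum_insert he]
    rw [h2, h]
    exact ih.conv

theorem expWeights_sum_le_le (S : Finset E) {x : ℝ} (hx : 0 ≤ x) :
    (expWeights E).real {w | ∑ e ∈ S, w e ≤ x} ≤ x ^ S.card / S.card.factorial := by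
  have h := (erlangBounds_sum S).le x hx
  rw [Measure.map_apply (by fun_prop) measurableSet_Iic] at h
  exact ENNReal.toReal_le_of_le_ofReal (by positivity) h

theorem le_expWeights_sum_le (S : Finset E) {x : ℝ} (hx : 0 ≤ x) :
    Real.exp (-x) * (x ^ S.card / S.card.factorial) ≤
      (expWeights E).real {w | ∑ e ∈ S, w e ≤ x} := by
  have h := (erlangBounds_sum S).ge x hx
  rw [Measure.map_apply (by fun_prop) measurableSet_Iic] at h
  exact (ENNReal.ofReal_le_iff_le_toReal (measure_ne_top _ _)).1 h

theorem ae_nonneg_expWeights : ∀ᵐ w ∂expWeights E, ∀ e, 0 ≤ w e := by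
  rw [ae_all_iff]
  intro e
  have h := ae_nonneg_expMeasure
  rw [← map_eval_expWeights e] at h
  exact ae_of_ae_map (measurable_pi_apply e).aemeasurable h

theorem expWeights_forall_le_le (S : Finset E) {q : ℝ} (hq : 0 ≤ q) :
    (expWeights E).real {w | ∀ e ∈ S, w e ≤ q} ≤ q ^ S.card := by
  have h := iIndepFun_expWeights.measure_inter_preimage_eq_mul (ι := E) S
    (sets := fun _ => Set.Iic q) fun _ _ => measurableSet_Iic
  have hset : {w : E → ℝ | ∀ e ∈ S, w e ≤ q} = ⋂ e ∈ S, (fun w : E → ℝ => w e) ⁻¹' Set.Iic q := by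
    ext w; simp
  refine ENNReal.toReal_le_of_le_ofReal (by positivity) ?_
  rw [hset, h, ENNReal.ofReal_pow hq, ← Finset.prod_const]
  refine Finset.prod_le_prod' fun e _ => ?_
  rw [← Measure.map_apply (measurable_pi_apply e) measurableSet_Iic, map_eval_expWeights]
  exact expMeasure_Iic_le hq

/-- Two light sets of edges force every edge of their union to be light. -/
theorem expWeights_inter_sum_le_le [DecidableEq E] (S T : Finset E) {x y q : ℝ} (hx : x ≤ q)
    (hy : y ≤ q) (hq : 0 ≤ q) :
    (expWeights E).real ({w | ∑ e ∈ S, w e ≤ x} ∩ {w | ∑ e ∈ T, w e ≤ y}) ≤ q ^ (S ∪ T).card := by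
  refine le_trans ?_ (expWeights_forall_le_le (S ∪ T) hq)
  refine ENNReal.toReal_mono (measure_ne_top _ _) (measure_mono_ae ?_)
  filter_upwards [ae_nonneg_expWeights (E := E)] with w hw
  rintro ⟨h1, h2⟩ e he
  rcases Finset.mem_union.1 he with he | he
  · exact (Finset.single_le_sum (fun e _ => hw e) he).trans (le_trans h1 hx)
  · exact (Finset.single_le_sum (fun e _ => hw e) he).trans (le_trans h2 hy)

theorem indepFun_of_dependsOn {β γ : Type*} [MeasurableSpace β] [MeasurableSpace γ]
    {S T : Finset E} (hST : Disjoint S T)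
    {X : (E → ℝ) → β} {Y : (E → ℝ) → γ} (hX : Measurable X) (hY : Measurable Y)
    (hXS : DependsOn X S) (hYT : DependsOn Y T) : IndepFun X Y (expWeights E) := by
  classical
  have h := iIndepFun_expWeights.indepFun_finset S T hST (fun e => measurable_pi_apply e)
  let ext (U : Finset E) (u : U → ℝ) (e : E) : ℝ := if h : e ∈ U then u ⟨e, h⟩ else 0
  have hext : ∀ U, Measurable (ext U) := fun U => measurable_pi_lambda _ fun e => by
    by_cases h : e ∈ U
    · simpa [ext, h] using measurable_pi_apply _
    · simp [ext, h]
  have h2 := h.comp (hX.comp (hext S)) (hY.comp (hext T))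
  convert! h2 using 1
  · ext w
    exact hXS fun e he => by simp [ext, Finset.mem_coe.1 he]
  · ext w
    exact hYT fun e he => by simp [ext, Finset.mem_coe.1 he]

end Product

/-! ### Light cycles in an abstract system of cycles -/

/-- A system of cycles on the vertex set `V` with edges in `E`, indexed by `ι`, having
`ρ k * (|V|)_k` members of length `k`. -/
structure CycleSystem (V E ι : Type*) [Fintype V] [DecidableEq V] [DecidableEq E] [Fintype ι]
    (ρ : ℕ → ℝ) where
  verts : ι → Finset V
  edges : ι → Finset E
  card_edges : ∀ a, (edges a).card = (verts a).card
  nonempty : ∀ a, (verts a).Nonempty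
  disjoint_edges : ∀ a b, Disjoint (verts a) (verts b) → Disjoint (edges a) (edges b)
  card_union_lt : ∀ a b, a ≠ b → ¬Disjoint (verts a) (verts b) →
    (verts a ∪ verts b).card < (edges a ∪ edges b).card
  card_subset_le : ∀ U : Finset V,
    (Finset.univ.filter fun a => verts a ⊆ U).card ≤ U.card.factorial
  card_length : ∀ k, ((Finset.univ.filter fun a => (verts a).card = k).card : ℝ) =
    ρ k * ((Fintype.card V).descFactorial k : ℕ)

namespace CycleSystem

section Finite

variable {V E ι : Type*} [Fintype V] [DecidableEq V] [DecidableEq E] [Fintype ι] {ρ : ℕ → ℝ}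

/-- The event that the cycle `a` has mean weight at most `x`. -/
def light (𝒞 : CycleSystem V E ι ρ) (x : ℝ) (a : ι) : Set (E → ℝ) :=
  {w | ∑ e ∈ 𝒞.edges a, w e ≤ (𝒞.verts a).card * x}

/-- The subsystem of the cycles of length at most `K`. -/
def truncate (𝒞 : CycleSystem V E ι ρ) (K : ℕ) :
    CycleSystem V E {a // (𝒞.verts a).card ≤ K} (fun k => if k ≤ K then ρ k else 0) where
  verts a := 𝒞.verts a
  edges a := 𝒞.edges a
  card_edges a := 𝒞.card_edges a
  nonempty a := 𝒞.nonempty a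
  disjoint_edges a b := 𝒞.disjoint_edges a b
  card_union_lt a b h := 𝒞.card_union_lt a b fun h' => h (Subtype.ext h')
  card_subset_le U := by
    refine le_trans ?_ (𝒞.card_subset_le U)
    refine Finset.card_le_card_of_injOn Subtype.val (fun a ha => ?_) Subtype.val_injective.injOn
    simpa using ha
  card_length k := by
    split_ifs with hk
    · rw [← 𝒞.card_length k]
      congr 1
      refine Finset.card_bij (fun a _ => a.1) (fun a ha => by simpa using ha)
        (fun a _ b _ h => Subtype.ext h) fun a ha => ?_
      have ha' : (𝒞.verts a).card = k := by simpa using ha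
      exact ⟨⟨a, ha'.trans_le hk⟩, by simpa using ha', rfl⟩
    · rw [zero_mul, Nat.cast_eq_zero, Finset.card_eq_zero, Finset.filter_eq_empty_iff]
      rintro ⟨a, ha⟩ - rfl
      exact hk ha

theorem measurableSet_light (𝒞 : CycleSystem V E ι ρ) (x : ℝ) (a : ι) :
    MeasurableSet (𝒞.light x a) :=
  measurableSet_sum_le _ _

theorem dependsOn_light (𝒞 : CycleSystem V E ι ρ) (x : ℝ) (a : ι) :
    DependsOn (fun w => w ∈ 𝒞.light x a) (𝒞.edges a) := fun w w' h => by
  simp only [light, Set.mem_ofPred_eq]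
  rw [Finset.sum_congr rfl fun e he => h e he]

theorem sum_apply_card (𝒞 : CycleSystem V E ι ρ) {s : Finset ℕ}
    (hs : ∀ a, (𝒞.verts a).card ∈ s) (g : ℕ → ℝ) :
    ∑ a, g (𝒞.verts a).card =
      ∑ k ∈ s, ρ k * ((Fintype.card V).descFactorial k : ℕ) * g k := by
  rw [← Finset.sum_fiberwise_of_maps_to (g := fun a => (𝒞.verts a).card) (t := s)
    (fun a _ => hs a)]
  refine Finset.sum_congr rfl fun k _ => ?_
  rw [Finset.sum_congr rfl fun a ha => by rw [(Finset.mem_filter.1 ha).2], Finset.sum_const,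
    nsmul_eq_mul, 𝒞.card_length]

theorem sum_pow_card_union_le (𝒞 : CycleSystem V E ι ρ) {K : ℕ}
    (hK : ∀ a, (𝒞.verts a).card ≤ K) {q : ℝ} (hq : 0 ≤ q) :
    ∑ a, ∑ b, q ^ (𝒞.verts a ∪ 𝒞.verts b).card ≤
      ((2 * K).factorial : ℝ) ^ 2 * Real.exp (Fintype.card V * q) := by
  have hU : ∀ p : ι × ι, (𝒞.verts p.1 ∪ 𝒞.verts p.2).card ≤ 2 * K := fun p =>
    (Finset.card_union_le _ _).trans (by linarith [hK p.1, hK p.2])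
  rw [← Fintype.sum_prod_type' fun a b => q ^ (𝒞.verts a ∪ 𝒞.verts b).card,
    ← Finset.sum_fiberwise_of_maps_to (g := fun p : ι × ι => 𝒞.verts p.1 ∪ 𝒞.verts p.2)
      (t := Finset.univ) (fun a _ => Finset.mem_univ _)]
  have hfib : ∀ U : Finset V, ∑ p : ι × ι with 𝒞.verts p.1 ∪ 𝒞.verts p.2 = U,
      q ^ (𝒞.verts p.1 ∪ 𝒞.verts p.2).card ≤ ((2 * K).factorial : ℝ) ^ 2 * q ^ U.card := by
    intro U
    rw [Finset.sum_congr rfl fun p hp => by rw [(Finset.mem_filter.1 hp).2], Finset.sum_const,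
      nsmul_eq_mul]
    refine mul_le_mul_of_nonneg_right ?_ (by positivity)
    rcases (Finset.univ.filter fun p : ι × ι =>
      𝒞.verts p.1 ∪ 𝒞.verts p.2 = U).eq_empty_or_nonempty with h | ⟨p, hp⟩
    · rw [h]
      simp only [Finset.card_empty, Nat.cast_zero]
      positivity
    · have hUK : U.card ≤ 2 * K := (Finset.mem_filter.1 hp).2 ▸ hU p
      have hsub : (Finset.univ.filter fun p : ι × ι => 𝒞.verts p.1 ∪ 𝒞.verts p.2 = U) ⊆
          (Finset.univ.filter fun a => 𝒞.verts a ⊆ U) ×ˢ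
            (Finset.univ.filter fun a => 𝒞.verts a ⊆ U) := by
        intro p hp
        have hp' := (Finset.mem_filter.1 hp).2
        simp only [Finset.mem_product, Finset.mem_filter, Finset.mem_univ, true_and]
        exact ⟨hp' ▸ Finset.subset_union_left, hp' ▸ Finset.subset_union_right⟩
      have h1 := Finset.card_le_card hsub
      rw [Finset.card_product, ← sq] at h1
      have h2 := (𝒞.card_subset_le U).trans (Nat.factorial_le hUK)
      exact_mod_cast h1.trans (Nat.pow_le_pow_left h2 2)
  refine (Finset.sum_le_sum fun U _ => hfib U).trans ?_
  rw [← Finset.mul_sum]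
  refine mul_le_mul_of_nonneg_left ?_ (by positivity)
  have h := Fintype.sum_pow_mul_eq_add_pow V q 1
  simp only [one_pow, mul_one] at h
  rw [h, mul_comm, Real.exp_mul, Real.rpow_natCast]
  exact pow_le_pow_left₀ (by positivity) (Real.add_one_le_exp q) _

variable [Fintype E]

theorem abs_measure_no_light_sub_exp_le (𝒞 : CycleSystem V E ι ρ) {K : ℕ}
    (hK : ∀ a, (𝒞.verts a).card ≤ K) {x : ℝ} (hx : 0 ≤ x) (hKx : K * x ≤ 1) :
    |(expWeights E).real {w | ∀ a, w ∉ 𝒞.light x a} -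
        Real.exp (-∑ a, (expWeights E).real (𝒞.light x a))| ≤
      2 * (K * x) *
        (((2 * K).factorial : ℝ) ^ 2 * Real.exp (Fintype.card V * (K * x))) := by
  classical
  set q := K * x with hqdef
  have hq : 0 ≤ q := by positivity
  have hxq : ∀ a, (𝒞.verts a).card * x ≤ q := fun a =>
    mul_le_mul_of_nonneg_right (by exact_mod_cast hK a) hx
  let D : ι → Finset ι := fun a => Finset.univ.filter fun b => ¬Disjoint (𝒞.verts a) (𝒞.verts b)
  have hDmem : ∀ a b, b ∈ D a ↔ ¬Disjoint (𝒞.verts a) (𝒞.verts b) := by simp [D]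
  have hD : ∀ a, a ∈ D a := fun a => by
    rw [hDmem, disjoint_self]
    exact (𝒞.nonempty a).ne_empty
  have hcs := abs_measure_forall_notMem_sub_exp_le (expWeights E) (𝒞.light x)
    (𝒞.measurableSet_light x) D hD fun a => by
      refine indepFun_of_dependsOn (S := 𝒞.edges a) (T := (𝒞.edges a)ᶜ) disjoint_compl_right
        (measurable_const.indicator (𝒞.measurableSet_light x a))
        (measurable_eventCount (𝒞.measurableSet_light x) _) (fun w w' h => ?_) fun w w' h => ?_
      · have := 𝒞.dependsOn_light x a h
        simp only [Set.indicator_apply]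
        simp only [this]
      · refine Finset.sum_congr rfl fun b hb => ?_
        have hdisj : Disjoint (𝒞.verts a) (𝒞.verts b) := by
          by_contra hc
          exact Finset.mem_compl.1 hb ((hDmem a b).2 hc)
        have := 𝒞.dependsOn_light x b fun e he => h e (by
          have := Finset.disjoint_right.1 (𝒞.disjoint_edges a b hdisj) (Finset.mem_coe.1 he)
          simpa using this)
        simp only [this]
  refine hcs.trans ?_
  have hp : ∀ a, (expWeights E).real (𝒞.light x a) ≤ q ^ (𝒞.verts a).card := fun a => by
    have h := expWeights_inter_sum_le_le (𝒞.edges a) (𝒞.edges a) (hxq a) (hxq a) hq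
    rwa [Set.inter_self, Finset.union_self, 𝒞.card_edges] at h
  have hpow0 : ∀ a b, 0 ≤ q * q ^ (𝒞.verts a ∪ 𝒞.verts b).card := fun a b => by positivity
  have h1 : ∀ a, ∑ b ∈ D a, (expWeights E).real (𝒞.light x a) * (expWeights E).real (𝒞.light x b)
      ≤ ∑ b, q * q ^ (𝒞.verts a ∪ 𝒞.verts b).card := fun a => by
    refine (Finset.sum_le_sum fun b hb => ?_).trans
      (Finset.sum_le_univ_sum_of_nonneg fun b => hpow0 a b)
    refine (mul_le_mul (hp a) (hp b) measureReal_nonneg (by positivity)).trans ?_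
    rw [← pow_add, ← pow_succ']
    refine pow_le_pow_of_le_one hq hKx ?_
    rw [← Finset.card_union_add_card_inter]
    have : 0 < (𝒞.verts a ∩ 𝒞.verts b).card := by
      rw [Finset.card_pos, ← Finset.not_disjoint_iff_nonempty_inter]
      exact (hDmem a b).1 hb
    omega
  have h2 : ∀ a, ∑ b ∈ (D a).erase a, (expWeights E).real (𝒞.light x a ∩ 𝒞.light x b)
      ≤ ∑ b, q * q ^ (𝒞.verts a ∪ 𝒞.verts b).card := fun a => by
    refine (Finset.sum_le_sum fun b hb => ?_).trans
      (Finset.sum_le_univ_sum_of_nonneg fun b => hpow0 a b)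
    obtain ⟨hne, hb⟩ := Finset.mem_erase.1 hb
    refine (expWeights_inter_sum_le_le (𝒞.edges a) (𝒞.edges b) (hxq a) (hxq b) hq).trans ?_
    rw [← pow_succ']
    exact pow_le_pow_of_le_one hq hKx (𝒞.card_union_lt a b (Ne.symm hne) ((hDmem a b).1 hb))
  refine (add_le_add (Finset.sum_le_sum fun a _ => h1 a)
    (Finset.sum_le_sum fun a _ => h2 a)).trans ?_
  have h3 := mul_le_mul_of_nonneg_left (𝒞.sum_pow_card_union_le hK hq) hq
  simp_rw [← Finset.mul_sum]
  linarith

theorem measure_light_le (𝒞 : CycleSystem V E ι ρ) {x : ℝ} (hx : 0 ≤ x) (a : ι) :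
    (expWeights E).real (𝒞.light x a) ≤
      ((𝒞.verts a).card * x) ^ (𝒞.verts a).card / (𝒞.verts a).card.factorial := by
  have h := expWeights_sum_le_le (𝒞.edges a)
    (by positivity : 0 ≤ ((𝒞.verts a).card : ℝ) * x)
  rwa [𝒞.card_edges] at h

theorem le_measure_light (𝒞 : CycleSystem V E ι ρ) {x : ℝ} (hx : 0 ≤ x) (a : ι) :
    Real.exp (-((𝒞.verts a).card * x)) *
        (((𝒞.verts a).card * x) ^ (𝒞.verts a).card / (𝒞.verts a).card.factorial) ≤
      (expWeights E).real (𝒞.light x a) := by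
  have h := le_expWeights_sum_le (𝒞.edges a)
    (by positivity : 0 ≤ ((𝒞.verts a).card : ℝ) * x)
  rwa [𝒞.card_edges] at h

theorem measure_no_light_le_truncate (𝒞 : CycleSystem V E ι ρ) (K : ℕ) (x : ℝ) :
    (expWeights E).real {w | ∀ a, w ∉ 𝒞.light x a} ≤
      (expWeights E).real {w | ∀ a, w ∉ (𝒞.truncate K).light x a} :=
  measureReal_mono fun _ hw a => hw a.1

/-- Long light cycles are controlled by the union bound. -/
theorem measure_no_light_truncate_le (𝒞 : CycleSystem V E ι ρ) (hρ : ∀ k, 0 ≤ ρ k) (K : ℕ)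
    {c : ℝ} (hc : 0 ≤ c) (hV : 0 < Fintype.card V) :
    (expWeights E).real {w | ∀ a, w ∉ (𝒞.truncate K).light (c / Fintype.card V) a} ≤
      (expWeights E).real {w | ∀ a, w ∉ 𝒞.light (c / Fintype.card V) a} +
        ∑ k ∈ Finset.Ioc K (Fintype.card V), ρ k * ((k : ℝ) ^ k * c ^ k / k.factorial) := by
  set n := Fintype.card V with hn
  set x := c / n with hxdef
  have hn0 : (0 : ℝ) < n := by exact_mod_cast hV
  have hx : 0 ≤ x := by positivity
  have hsub : {w | ∀ a, w ∉ (𝒞.truncate K).light x a} ⊆ {w | ∀ a, w ∉ 𝒞.light x a} ∪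
      ⋃ a ∈ Finset.univ.filter (fun a => K < (𝒞.verts a).card), 𝒞.light x a := by
    intro w hw
    by_cases h : ∀ a, w ∉ 𝒞.light x a
    · exact Or.inl h
    · push Not at h
      obtain ⟨a, ha⟩ := h
      refine Or.inr (Set.mem_iUnion₂.2 ⟨a, ?_, ha⟩)
      simp only [Finset.mem_filter, Finset.mem_univ, true_and]
      by_contra hle
      exact hw ⟨a, not_lt.1 hle⟩ ha
  refine (measureReal_mono hsub).trans ((measureReal_union_le _ _).trans ?_)
  gcongr
  refine (measureReal_biUnion_finset_le _ _).trans ?_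
  rw [Finset.sum_filter]
  have hle : ∀ a, (if K < (𝒞.verts a).card then (expWeights E).real (𝒞.light x a) else 0) ≤
      (fun k : ℕ => if K < k then ((k : ℝ) * x) ^ k / k.factorial else 0) (𝒞.verts a).card := by
    intro a
    dsimp only
    split_ifs
    · exact 𝒞.measure_light_le hx a
    · exact le_rfl
  refine (Finset.sum_le_sum fun a _ => hle a).trans ?_
  rw [𝒞.sum_apply_card (s := Finset.range (n + 1)) (fun a =>
    Finset.mem_range.2 (Nat.lt_succ_of_le (Finset.card_le_univ _)))
    fun k : ℕ => if K < k then ((k : ℝ) * x) ^ k / k.factorial else 0]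
  have hIoc : Finset.Ioc K n = (Finset.range (n + 1)).filter fun k => K < k := by
    ext k; simp [and_comm]
  rw [hIoc, Finset.sum_filter]
  refine Finset.sum_le_sum fun k _ => ?_
  split_ifs with hk
  · rw [mul_assoc]
    refine mul_le_mul_of_nonneg_left ?_ (hρ k)
    rw [← mul_div_assoc]
    refine div_le_div_of_nonneg_right ?_ (by positivity)
    have hd : ((n.descFactorial k : ℕ) : ℝ) ≤ (n : ℝ) ^ k := by
      exact_mod_cast Nat.descFactorial_le_pow n k
    refine (mul_le_mul_of_nonneg_right hd (by positivity)).trans_eq ?_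
    rw [← mul_pow, ← mul_pow, hxdef]
    congr 1
    field_simp
  · simp

end Finite

section Limit

theorem tendsto_descFactorial_mul_div_pow (k : ℕ) (y : ℝ) :
    Tendsto (fun n : ℕ => ((n.descFactorial k : ℕ) : ℝ) * (y / n) ^ k) atTop (𝓝 (y ^ k)) := by
  have h := (isEquivalent_descFactorial k)
  rw [Asymptotics.isEquivalent_iff_tendsto_one] at h
  · have h2 := h.mul_const (y ^ k)
    rw [one_mul] at h2
    refine h2.congr fun n => ?_
    simp only [Pi.div_apply, div_pow]
    ring
  · filter_upwards [eventually_gt_atTop 0] with n hn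
    positivity

variable {E ι : ℕ → Type*} [∀ n, Fintype (E n)] [∀ n, DecidableEq (E n)] [∀ n, Fintype (ι n)]
  {ρ : ℕ → ℝ}

theorem tendsto_sum_measure_light (𝒞 : ∀ n, CycleSystem (Fin n) (E n) (ι n) ρ)
    {K : ℕ} (hK : ∀ n a, ((𝒞 n).verts a).card ≤ K) {c : ℝ} (hc : 0 ≤ c) :
    Tendsto (fun n : ℕ => ∑ a, (expWeights (E n)).real ((𝒞 n).light (c / n) a)) atTop
      (𝓝 (∑ k ∈ Finset.range (K + 1), ρ k * ((k : ℝ) ^ k * c ^ k / k.factorial))) := by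
  have hmem : ∀ n a, ((𝒞 n).verts a).card ∈ Finset.range (K + 1) := fun n a =>
    Finset.mem_range.2 (Nat.lt_succ_of_le (hK n a))
  have hterm : ∀ k : ℕ, Tendsto (fun n : ℕ => ρ k * ((n.descFactorial k : ℕ) : ℝ) *
      (((k : ℝ) * (c / n)) ^ k / k.factorial)) atTop
        (𝓝 (ρ k * ((k : ℝ) ^ k * c ^ k / k.factorial))) := fun k => by
    have h := ((tendsto_descFactorial_mul_div_pow k (k * c)).const_mul (ρ k)).div_const
      (k.factorial : ℝ)
    rw [mul_pow, mul_div_assoc] at h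
    refine h.congr fun n => ?_
    rw [mul_div_assoc (k : ℝ) c]
    ring
  have hexp : ∀ k : ℕ, Tendsto (fun n : ℕ => Real.exp (-((k : ℝ) * (c / n)))) atTop (𝓝 1) :=
    fun k => by
      have h : Tendsto (fun n : ℕ => -((k : ℝ) * (c / n))) atTop (𝓝 0) := by
        simpa using ((tendsto_const_div_atTop_nhds_zero_nat c).const_mul (k : ℝ)).neg
      rw [← Real.exp_zero]
      exact (Real.continuous_exp.tendsto 0).comp h
  have hupper : ∀ n : ℕ, ∑ a, (expWeights (E n)).real ((𝒞 n).light (c / n) a) ≤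
      ∑ k ∈ Finset.range (K + 1), ρ k * ((n.descFactorial k : ℕ) : ℝ) *
        (((k : ℝ) * (c / n)) ^ k / k.factorial) := fun n => by
    have h := (𝒞 n).sum_apply_card (hmem n) fun k => ((k : ℝ) * (c / n)) ^ k / k.factorial
    rw [Fintype.card_fin] at h
    rw [← h]
    exact Finset.sum_le_sum fun a _ => (𝒞 n).measure_light_le (by positivity) a
  have hlower : ∀ n : ℕ, ∑ k ∈ Finset.range (K + 1), Real.exp (-((k : ℝ) * (c / n))) *
      (ρ k * ((n.descFactorial k : ℕ) : ℝ) * (((k : ℝ) * (c / n)) ^ k / k.factorial)) ≤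
        ∑ a, (expWeights (E n)).real ((𝒞 n).light (c / n) a) := fun n => by
    have h := (𝒞 n).sum_apply_card (hmem n) fun k =>
      Real.exp (-((k : ℝ) * (c / n))) * (((k : ℝ) * (c / n)) ^ k / k.factorial)
    rw [Fintype.card_fin] at h
    refine le_trans (le_of_eq ?_)
      (Finset.sum_le_sum fun a _ => (𝒞 n).le_measure_light (by positivity : 0 ≤ c / n) a)
    rw [h]
    exact Finset.sum_congr rfl fun k _ => by ring
  refine tendsto_of_tendsto_of_tendsto_of_le_of_le (tendsto_finsetSum _ fun k _ => ?_)
    (tendsto_finsetSum _ fun k _ => hterm k) hlower hupper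
  simpa using (hexp k).mul (hterm k)

theorem tendsto_measure_no_light_of_card_le (𝒞 : ∀ n, CycleSystem (Fin n) (E n) (ι n) ρ)
    {K : ℕ} (hK : ∀ n a, ((𝒞 n).verts a).card ≤ K) {c : ℝ} (hc : 0 ≤ c) :
    Tendsto (fun n : ℕ => (expWeights (E n)).real {w | ∀ a, w ∉ (𝒞 n).light (c / n) a}) atTop
      (𝓝 (Real.exp (-∑ k ∈ Finset.range (K + 1),
        ρ k * ((k : ℝ) ^ k * c ^ k / k.factorial)))) := by
  have h1 : Tendsto (fun n : ℕ =>
      Real.exp (-∑ a, (expWeights (E n)).real ((𝒞 n).light (c / n) a))) atTop _ :=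
    (Real.continuous_exp.tendsto _).comp (tendsto_sum_measure_light 𝒞 hK hc).neg
  have hKx : Tendsto (fun n : ℕ => (K : ℝ) * (c / n)) atTop (𝓝 0) := by
    simpa using (tendsto_const_div_atTop_nhds_zero_nat c).const_mul (K : ℝ)
  have hbound : Tendsto (fun n : ℕ => 2 * ((K : ℝ) * (c / n)) *
      (((2 * K).factorial : ℝ) ^ 2 * Real.exp (K * c))) atTop (𝓝 0) := by
    simpa using (hKx.const_mul 2).mul_const (((2 * K).factorial : ℝ) ^ 2 * Real.exp (K * c))
  have h2 : Tendsto (fun n : ℕ => (expWeights (E n)).real {w | ∀ a, w ∉ (𝒞 n).light (c / n) a} -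
      Real.exp (-∑ a, (expWeights (E n)).real ((𝒞 n).light (c / n) a))) atTop (𝓝 0) := by
    refine squeeze_zero_norm' ?_ hbound
    filter_upwards [eventually_gt_atTop 0, hKx.eventually (eventually_le_nhds one_pos)]
      with n hn hle
    have h := (𝒞 n).abs_measure_no_light_sub_exp_le (hK n) (by positivity : 0 ≤ c / n) hle
    rw [Fintype.card_fin] at h
    have hn0 : (n : ℝ) ≠ 0 := by positivity
    rwa [show (n : ℝ) * (K * (c / n)) = K * c by field_simp] at h
  simpa using h2.add h1

theorem tendsto_measure_no_light_truncate (𝒞 : ∀ n, CycleSystem (Fin n) (E n) (ι n) ρ)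
    (K : ℕ) {c : ℝ} (hc : 0 ≤ c) :
    Tendsto (fun n : ℕ =>
      (expWeights (E n)).real {w | ∀ a, w ∉ ((𝒞 n).truncate K).light (c / n) a}) atTop
      (𝓝 (Real.exp (-∑ k ∈ Finset.range (K + 1),
        ρ k * ((k : ℝ) ^ k * c ^ k / k.factorial)))) := by
  have h := tendsto_measure_no_light_of_card_le (fun n => (𝒞 n).truncate K)
    (fun n a => a.2) hc
  rwa [Finset.sum_congr rfl fun k hk => by
    rw [if_pos (Nat.lt_succ_iff.1 (Finset.mem_range.1 hk))]] at h

theorem tendsto_measure_no_light_of_not_summable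
    (𝒞 : ∀ n, CycleSystem (Fin n) (E n) (ι n) ρ) (hρ : ∀ k, 0 ≤ ρ k) {c : ℝ} (hc : 0 ≤ c)
    (hs : ¬Summable fun k : ℕ => ρ k * ((k : ℝ) ^ k * c ^ k / k.factorial)) :
    Tendsto (fun n : ℕ => (expWeights (E n)).real {w | ∀ a, w ∉ (𝒞 n).light (c / n) a}) atTop
      (𝓝 0) := by
  have hs' := (not_summable_iff_tendsto_nat_atTop_of_nonneg fun k => by
    have := hρ k; positivity).1 hs
  have h0 := (Real.tendsto_exp_neg_atTop_nhds_zero.comp hs').comp (tendsto_add_atTop_nat 1)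
  refine Metric.tendsto_atTop'.2 fun ε hε => ?_
  obtain ⟨K, hK⟩ := (h0.eventually (gt_mem_nhds hε)).exists
  obtain ⟨N, hN⟩ := eventually_atTop.1
    ((tendsto_measure_no_light_truncate 𝒞 K hc).eventually (gt_mem_nhds hK))
  refine ⟨N, fun n hn => ?_⟩
  rw [Real.dist_0_eq_abs, abs_of_nonneg measureReal_nonneg]
  exact ((𝒞 n).measure_no_light_le_truncate K _).trans_lt (hN n hn.le)

theorem tendsto_measure_no_light_of_summable
    (𝒞 : ∀ n, CycleSystem (Fin n) (E n) (ι n) ρ) (hρ : ∀ k, 0 ≤ ρ k) {c : ℝ} (hc : 0 ≤ c)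
    (hs : Summable fun k : ℕ => ρ k * ((k : ℝ) ^ k * c ^ k / k.factorial)) :
    Tendsto (fun n : ℕ => (expWeights (E n)).real {w | ∀ a, w ∉ (𝒞 n).light (c / n) a}) atTop
      (𝓝 (Real.exp (-∑' k : ℕ, ρ k * ((k : ℝ) ^ k * c ^ k / k.factorial)))) := by
  set s : ℕ → ℝ := fun k => ρ k * ((k : ℝ) ^ k * c ^ k / k.factorial) with hsdef
  have hs0 : ∀ k, 0 ≤ s k := fun k => by have := hρ k; positivity
  have hS := hs.hasSum.tendsto_sum_nat.comp (tendsto_add_atTop_nat 1)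
  have hE : Tendsto (fun K => Real.exp (-∑ k ∈ Finset.range (K + 1), s k)) atTop
      (𝓝 (Real.exp (-∑' k, s k))) := (Real.continuous_exp.tendsto _).comp hS.neg
  refine Metric.tendsto_atTop'.2 fun ε hε => ?_
  obtain ⟨K, hK1, hK2⟩ := ((hE.eventually (Metric.ball_mem_nhds _ (by positivity : 0 < ε / 3))).and
    (hS.eventually (Metric.ball_mem_nhds _ (by positivity : 0 < ε / 3)))).exists
  obtain ⟨N, hN⟩ := eventually_atTop.1
    ((tendsto_measure_no_light_truncate 𝒞 K hc).eventually
      (Metric.ball_mem_nhds _ (by positivity : 0 < ε / 3)))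
  refine ⟨N, fun n hn => ?_⟩
  have h3 := hN n hn.le
  have hn0 : 0 < n := (Nat.zero_le N).trans_lt hn
  have hle := (𝒞 n).measure_no_light_le_truncate K (c / n)
  have hge := (𝒞 n).measure_no_light_truncate_le hρ K hc (by simpa using hn0)
  rw [Fintype.card_fin] at hge
  have htail : ∑ k ∈ Finset.Ioc K n, s k ≤
      ∑' k, s k - ∑ k ∈ Finset.range (K + 1), s k := by
    rw [le_sub_iff_add_le, ← Finset.sum_union]
    · exact hs.sum_le_tsum _ fun k _ => hs0 k
    · rw [Finset.disjoint_left]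
      intro k hk hk'
      have := (Finset.mem_Ioc.1 hk).1
      have := Finset.mem_range.1 hk'
      omega
  simp only [Real.dist_eq, Function.comp_apply] at hK1 hK2 h3 ⊢
  rw [abs_lt] at *
  constructor <;> linarith [hK1.1, hK1.2, hK2.1, hK2.2, h3.1, h3.2]

end Limit

end CycleSystem

/-! ### Cycles as permutations -/

open Equiv.Perm

section Permutations

variable {V : Type*}

/-- The arc `v → σ v` at a vertex moved by the permutation `σ`. -/
def permArc (σ : Equiv.Perm V) (v : {v // σ v ≠ v}) : Arc V :=
  ⟨(v, σ v), fun h => v.2 h.symm⟩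

variable [Fintype V] [DecidableEq V]

/-- The images under `g` of the arcs of a permutation. -/
def permEdges {E : Type*} [DecidableEq E] (g : Arc V → E) (σ : Equiv.Perm V) : Finset E :=
  Finset.univ.image fun v => g (permArc σ v)

theorem mem_permEdges {E : Type*} [DecidableEq E] {g : Arc V → E} {σ : Equiv.Perm V} {e : E} :
    e ∈ permEdges g σ ↔ ∃ v, g (permArc σ v) = e := by
  simp [permEdges]

theorem card_subtype_apply_ne (σ : Equiv.Perm V) :
    Fintype.card {v // σ v ≠ v} = σ.support.card := by
  rw [Fintype.card_subtype]
  rfl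

theorem card_perm_support_subset (U : Finset V) :
    (Finset.univ.filter fun σ : Equiv.Perm V => σ.support ⊆ U).card ≤ U.card.factorial := by
  rw [← Fintype.card_coe U, ← Fintype.card_perm, ← Fintype.card_subtype]
  refine (Fintype.card_congr ((Equiv.subtypeEquivRight fun σ => ?_).trans
    (Equiv.Perm.subtypeEquivSubtypePerm (· ∈ U)).symm)).le
  constructor
  · intro h a ha
    by_contra hne
    exact ha (h (mem_support.2 hne))
  · intro h a ha
    by_contra hne
    exact mem_support.1 ha (h a hne)

/-- A family of cyclic permutations forms a system of cycles as soon as distinct cycles through a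
common vertex separate at some common vertex. -/
def CycleSystem.ofPerms {E : Type*} [DecidableEq E] {ρ : ℕ → ℝ} (Q : Equiv.Perm V → Prop)
    [DecidablePred Q] (hQ : ∀ σ, Q σ → σ.IsCycle) (g : Arc V → E)
    (hg : ∀ a b, g a = g b → s(a.1.1, a.1.2) = s(b.1.1, b.1.2))
    (hinj : ∀ σ, Q σ → Function.Injective fun v => g (permArc σ v))
    (hsep : ∀ σ τ, Q σ → Q τ → σ ≠ τ → ¬Disjoint σ.support τ.support →
      ∃ v : {v // τ v ≠ v}, v.1 ∈ σ.support ∧ g (permArc τ v) ∉ permEdges g σ)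
    (hcard : ∀ k, ((Finset.univ.filter fun σ : Equiv.Perm V => Q σ ∧ σ.support.card = k).card : ℝ) =
      ρ k * ((Fintype.card V).descFactorial k : ℕ)) :
    CycleSystem V E {σ // Q σ} ρ where
  verts σ := σ.1.support
  edges σ := permEdges g σ.1
  card_edges σ := by
    rw [permEdges, Finset.card_image_of_injective _ (hinj σ.1 σ.2), Finset.card_univ,
      card_subtype_apply_ne]
  nonempty σ := by
    rw [Finset.nonempty_iff_ne_empty, ne_eq, support_eq_empty_iff]
    exact (hQ σ.1 σ.2).ne_one
  disjoint_edges σ τ h := by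
    rw [Finset.disjoint_left]
    intro e he he'
    obtain ⟨v, rfl⟩ := mem_permEdges.1 he
    obtain ⟨u, hu⟩ := mem_permEdges.1 he'
    have hs := hg _ _ hu
    have hv1 : v.1 ∈ σ.1.support := mem_support.2 v.2
    have hu1 : u.1 ∈ τ.1.support := mem_support.2 u.2
    rcases Sym2.eq_iff.1 hs with ⟨h1, -⟩ | ⟨-, h2⟩
    · have h1' : u.1 = v.1 := h1
      exact Finset.disjoint_left.1 h hv1 (h1' ▸ hu1)
    · have h2' : τ.1 u.1 = v.1 := h2
      exact Finset.disjoint_left.1 h hv1 (h2' ▸ apply_mem_support.2 hu1)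
  card_union_lt σ τ hne hnd := by
    obtain ⟨v, hv, hvE⟩ := hsep σ.1 τ.1 σ.2 τ.2 (fun h => hne (Subtype.ext h)) hnd
    have hnew : ∀ u : {u // τ.1 u ≠ u}, u.1 ∉ σ.1.support ∨ u = v →
        g (permArc τ.1 u) ∉ permEdges g σ.1 := by
      rintro u (hu | rfl)
      · intro he
        obtain ⟨z, hz⟩ := mem_permEdges.1 he
        have hz1 : z.1 ∈ σ.1.support := mem_support.2 z.2
        rcases Sym2.eq_iff.1 (hg _ _ hz) with ⟨h1, -⟩ | ⟨-, h2⟩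
        · have h1' : z.1 = u.1 := h1
          exact hu (h1' ▸ hz1)
        · have h2' : σ.1 z.1 = u.1 := h2
          exact hu (h2' ▸ apply_mem_support.2 hz1)
      · exact hvE
    have hE : permEdges g σ.1 ∪ permEdges g τ.1 =
        permEdges g σ.1 ∪ (permEdges g τ.1 \ permEdges g σ.1) :=
      Finset.union_sdiff_self_eq_union.symm
    have hV : σ.1.support ∪ τ.1.support = σ.1.support ∪ (τ.1.support \ σ.1.support) :=
      Finset.union_sdiff_self_eq_union.symm
    rw [hE, hV, Finset.card_union_of_disjoint Finset.disjoint_sdiff,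
      Finset.card_union_of_disjoint Finset.disjoint_sdiff]
    have hcE : (permEdges g σ.1).card = σ.1.support.card := by
      rw [permEdges, Finset.card_image_of_injective _ (hinj σ.1 σ.2), Finset.card_univ,
        card_subtype_apply_ne]
    rw [hcE]
    refine Nat.add_lt_add_left ?_ _
    have hvn : v.1 ∉ τ.1.support \ σ.1.support := fun h => (Finset.mem_sdiff.1 h).2 hv
    rw [← Nat.succ_le_iff, Nat.succ_eq_add_one, ← Finset.card_insert_of_notMem hvn]
    have hmem : ∀ u ∈ insert v.1 (τ.1.support \ σ.1.support), τ.1 u ≠ u := by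
      intro u hu
      rcases Finset.mem_insert.1 hu with rfl | hu
      · exact v.2
      · exact mem_support.1 (Finset.mem_sdiff.1 hu).1
    refine Finset.card_le_card_of_injOn
      (fun u => if h : τ.1 u ≠ u then g (permArc τ.1 ⟨u, h⟩) else g (permArc τ.1 v)) ?_ ?_
    · intro u hu
      have hu' := hmem u hu
      simp only [dif_pos hu']
      refine Finset.mem_coe.2 (Finset.mem_sdiff.2 ⟨mem_permEdges.2 ⟨_, rfl⟩, hnew _ ?_⟩)
      rcases Finset.mem_insert.1 hu with rfl | hu
      · exact Or.inr rfl
      · exact Or.inl (Finset.mem_sdiff.1 hu).2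
    · intro u hu z hz h
      have hu' := hmem u hu
      have hz' := hmem z hz
      simp only [dif_pos hu', dif_pos hz'] at h
      exact congrArg Subtype.val (hinj τ.1 τ.2 h)
  card_subset_le U := by
    refine le_trans ?_ (card_perm_support_subset U)
    refine Finset.card_le_card_of_injOn Subtype.val (fun a ha => ?_) Subtype.val_injective.injOn
    simpa using ha
  card_length k := by
    rw [← hcard k]
    congr 1
    refine Finset.card_bij (fun a _ => a.1) (fun a ha => ?_) (fun a _ b _ h => Subtype.ext h)
      fun σ hσ => ?_
    · simpa using ⟨a.2, (Finset.mem_filter.1 ha).2⟩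
    · obtain ⟨-, hσ1, hσ2⟩ := Finset.mem_filter.1 hσ
      exact ⟨⟨σ, hσ1⟩, by simpa using hσ2, rfl⟩

noncomputable instance : DecidablePred (Equiv.Perm.IsCycle (α := V)) := Classical.decPred _

theorem card_cyclic_perms (k : ℕ) :
    ((Finset.univ.filter fun σ : Equiv.Perm V => σ.IsCycle ∧ σ.support.card = k).card : ℝ) =
      (if 2 ≤ k then 1 / (k : ℝ) else 0) * ((Fintype.card V).descFactorial k : ℕ) := by
  split_ifs with hk
  · rcases le_or_gt k (Fintype.card V) with hkV | hkV
    · have hset : (Finset.univ.filter fun σ : Equiv.Perm V => σ.IsCycle ∧ σ.support.card = k) =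
          Finset.univ.filter fun σ : Equiv.Perm V => σ.cycleType = {k} := by
        ext σ
        simp only [Finset.mem_filter, Finset.mem_univ, true_and]
        constructor
        · rintro ⟨h1, h2⟩
          rw [h1.cycleType, h2]
        · intro h
          have h1 : σ.IsCycle := card_cycleType_eq_one.1 (by rw [h]; rfl)
          refine ⟨h1, ?_⟩
          rw [h1.cycleType] at h
          exact Multiset.singleton_inj.1 h
      rw [hset, card_of_cycleType_singleton hk hkV, Nat.descFactorial_eq_factorial_mul_choose,
        ← Nat.mul_factorial_pred (by omega : k ≠ 0)]
      push_cast
      have : (k : ℝ) ≠ 0 := by positivity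
      field_simp
    · rw [Nat.descFactorial_of_lt hkV, Nat.cast_zero, mul_zero, Nat.cast_eq_zero,
        Finset.card_eq_zero, Finset.filter_eq_empty_iff]
      rintro σ - ⟨-, rfl⟩
      exact absurd (Finset.card_le_univ σ.support) (not_le.2 hkV)
  · rw [zero_mul, Nat.cast_eq_zero, Finset.card_eq_zero, Finset.filter_eq_empty_iff]
    rintro σ - ⟨h, rfl⟩
    exact hk h.two_le_card_support

theorem apply_apply_ne_of_three_le {σ : Equiv.Perm V} (h : σ.IsCycle) (h3 : 3 ≤ σ.support.card)
    {v : V} (hv : σ v ≠ v) : σ (σ v) ≠ v := by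
  intro heq
  have hs := h.eq_swap_of_apply_apply_eq_self hv heq
  rw [hs, card_support_swap (Ne.symm hv)] at h3
  omega

theorem eq_or_eq_inv_of_agree {σ τ : Equiv.Perm V} (hσ : σ.IsCycle) (hτ : τ.IsCycle)
    (h3 : 3 ≤ τ.support.card) (hnd : ¬Disjoint σ.support τ.support)
    (h : ∀ v ∈ σ.support ∩ τ.support, τ v = σ v ∨ τ v = σ⁻¹ v) : τ = σ ∨ τ = σ⁻¹ := by
  obtain ⟨x, hxσ, hxτ⟩ := Finset.not_disjoint_iff.1 hnd
  by_cases hall : ∀ v ∈ σ.support ∩ τ.support, τ v = σ⁻¹ v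
  · right
    refine hτ.eq_on_support_inter_nonempty_congr hσ.inv (fun v hv => hall v ?_)
      (hall x (Finset.mem_inter.2 ⟨hxσ, hxτ⟩)) hxτ
    rwa [support_inv, Finset.inter_comm] at hv
  · left
    push Not at hall
    obtain ⟨v, hv, hne⟩ := hall
    have hvσ : τ v = σ v := (h v hv).resolve_right hne
    obtain ⟨hv1, hv2⟩ := Finset.mem_inter.1 hv
    have hpow : ∀ n : ℕ, (τ ^ n) v ∈ σ.support ∧ τ ((τ ^ n) v) = σ ((τ ^ n) v) := by
      intro n
      induction n with
      | zero => exact ⟨hv1, hvσ⟩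
      | succ n ih =>
        set y := (τ ^ n) v with hy
        have hyτ : y ∈ τ.support := pow_apply_mem_support.2 hv2
        have hsucc : (τ ^ (n + 1)) v = τ y := by rw [pow_succ', mul_apply]
        rw [hsucc]
        have hmem : τ y ∈ σ.support := by rw [ih.2]; exact apply_mem_support.2 ih.1
        refine ⟨hmem, ?_⟩
        refine (h (τ y) (Finset.mem_inter.2 ⟨hmem, apply_mem_support.2 hyτ⟩)).resolve_right ?_
        intro hinv
        rw [ih.2, show σ⁻¹ (σ y) = y from σ.symm_apply_apply y, ← ih.2] at hinv
        exact apply_apply_ne_of_three_le hτ h3 (mem_support.1 hyτ) hinv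
    refine hτ.eq_on_support_inter_nonempty_congr hσ (fun u hu => ?_) hvσ hv2
    obtain ⟨n, rfl⟩ := hτ.exists_pow_eq (mem_support.1 hv2)
      (mem_support.1 (Finset.mem_inter.1 hu).1)
    exact (hpow n).2

end Permutations

/-! ### Directed cycles -/

section Directed

variable (V : Type*) [Fintype V] [DecidableEq V]

/-- The system of all directed cycles of the complete directed graph. -/
noncomputable def directedSystem :
    CycleSystem V (Arc V) {σ : Equiv.Perm V // σ.IsCycle}
      fun k => if 2 ≤ k then 1 / (k : ℝ) else 0 :=
  CycleSystem.ofPerms (fun σ => σ.IsCycle) (fun _ h => h) id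
    (fun a b h => by rw [show a = b from h])
    (fun σ _ u v h => Subtype.ext (congrArg (fun a : Arc V => a.1.1) h))
    (fun σ τ hσ hτ hne hnd => by
      obtain ⟨x, hxσ, hxτ⟩ := Finset.not_disjoint_iff.1 hnd
      by_contra! hcon
      have key : ∀ v ∈ σ.support ∩ τ.support, σ v = τ v := by
        intro v hv
        obtain ⟨h1, h2⟩ := Finset.mem_inter.1 hv
        obtain ⟨u, hu⟩ := mem_permEdges.1 (hcon ⟨v, mem_support.1 h2⟩ h1)
        have e1 : u.1 = v := congrArg (fun a : Arc V => a.1.1) hu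
        have e2 : σ u.1 = τ v := congrArg (fun a : Arc V => a.1.2) hu
        rw [← e2, e1]
      exact hne (hσ.eq_on_support_inter_nonempty_congr hτ key
        (key x (Finset.mem_inter.2 ⟨hxσ, hxτ⟩)) hxσ))
    card_cyclic_perms

end Directed

/-! ### Undirected cycles -/

section Undirected

variable {V : Type*}

/-- The edge underlying an arc. -/
def Arc.edge (a : Arc V) : Edge V := ⟨s(a.1.1, a.1.2), by simpa using a.2⟩

theorem edge_permArc_eq_iff {σ τ : Equiv.Perm V} {u : {v // σ v ≠ v}} {v : {v // τ v ≠ v}} :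
    (permArc σ u).edge = (permArc τ v).edge ↔
      (u.1 = v.1 ∧ σ u = τ v) ∨ (u.1 = τ v ∧ σ u = v.1) := by
  rw [Arc.edge, Arc.edge, Subtype.mk.injEq, Sym2.eq_iff]
  rfl

variable [Fintype V] [DecidableEq V]

/-- A choice of one of the two orientations of an undirected cycle. -/
def IsChosenCycle (σ : Equiv.Perm V) : Prop :=
  σ.IsCycle ∧ 3 ≤ σ.support.card ∧
    Fintype.equivFin (Equiv.Perm V) σ < Fintype.equivFin (Equiv.Perm V) σ⁻¹

noncomputable instance : DecidablePred (IsChosenCycle (V := V)) := Classical.decPred _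

theorem ne_inv_of_three_le {σ : Equiv.Perm V} (h : σ.IsCycle) (h3 : 3 ≤ σ.support.card) :
    σ ≠ σ⁻¹ := by
  obtain ⟨v, hv, -⟩ := id h
  intro heq
  refine apply_apply_ne_of_three_le h h3 hv ?_
  nth_rewrite 1 [heq]
  exact σ.symm_apply_apply v

theorem isChosenCycle_or_inv {σ : Equiv.Perm V} (h : σ.IsCycle) (h3 : 3 ≤ σ.support.card) :
    IsChosenCycle σ ∨ IsChosenCycle σ⁻¹ := by
  rcases lt_or_gt_of_ne (fun he => ne_inv_of_three_le h h3
    ((Fintype.equivFin (Equiv.Perm V)).injective he)) with hlt | hlt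
  · exact Or.inl ⟨h, h3, hlt⟩
  · exact Or.inr ⟨h.inv, by rwa [support_inv], by rwa [inv_inv]⟩

theorem IsChosenCycle.not_inv {σ : Equiv.Perm V} (h : IsChosenCycle σ) : ¬IsChosenCycle σ⁻¹ :=
  fun h' => lt_asymm h.2.2 (by simpa using h'.2.2)

theorem card_chosen_cycles (k : ℕ) :
    ((Finset.univ.filter fun σ : Equiv.Perm V => IsChosenCycle σ ∧ σ.support.card = k).card : ℝ) =
      (if 3 ≤ k then 1 / (2 * k : ℝ) else 0) * ((Fintype.card V).descFactorial k : ℕ) := by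
  split_ifs with hk
  · have hcyc := card_cyclic_perms (V := V) k
    rw [if_pos (by omega)] at hcyc
    set A := Finset.univ.filter fun σ : Equiv.Perm V => IsChosenCycle σ ∧ σ.support.card = k
    have hunion : (Finset.univ.filter fun σ : Equiv.Perm V => σ.IsCycle ∧ σ.support.card = k) =
        A ∪ A.image fun σ => σ⁻¹ := by
      ext σ
      simp only [A, Finset.mem_filter, Finset.mem_univ, true_and, Finset.mem_union,
        Finset.mem_image]
      constructor
      · rintro ⟨h1, h2⟩
        rcases isChosenCycle_or_inv h1 (by omega) with h | h
        · exact Or.inl ⟨h, h2⟩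
        · exact Or.inr ⟨σ⁻¹, ⟨h, by rwa [support_inv]⟩, inv_inv σ⟩
      · rintro (⟨h1, h2⟩ | ⟨τ, ⟨h1, h2⟩, rfl⟩)
        · exact ⟨h1.1, h2⟩
        · exact ⟨h1.1.inv, by rwa [support_inv]⟩
    have hdisj : Disjoint A (A.image fun σ => σ⁻¹) := by
      rw [Finset.disjoint_left]
      intro σ h1 h2
      obtain ⟨τ, h3, rfl⟩ := Finset.mem_image.1 h2
      exact (Finset.mem_filter.1 h3).2.1.not_inv (Finset.mem_filter.1 h1).2.1
    rw [hunion, Finset.card_union_of_disjoint hdisj,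
      Finset.card_image_of_injective _ inv_injective] at hcyc
    push_cast at hcyc
    have h2 : (A.card : ℝ) = (A.card + A.card) / 2 := by ring
    rw [h2, hcyc]
    have : (k : ℝ) ≠ 0 := by positivity
    field_simp
  · rw [zero_mul, Nat.cast_eq_zero, Finset.card_eq_zero, Finset.filter_eq_empty_iff]
    rintro σ - ⟨h, rfl⟩
    exact hk h.2.1

theorem injective_edge_permArc {σ : Equiv.Perm V} (h : σ.IsCycle) (h3 : 3 ≤ σ.support.card) :
    Function.Injective fun v => (permArc σ v).edge := by
  intro u v huv
  rcases edge_permArc_eq_iff.1 huv with ⟨h1, -⟩ | ⟨h1, h2⟩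
  · exact Subtype.ext h1
  · rw [h1] at h2
    exact absurd h2 (apply_apply_ne_of_three_le h h3 v.2)

theorem permEdges_edge_inv (σ : Equiv.Perm V) :
    permEdges Arc.edge σ⁻¹ = permEdges Arc.edge σ := by
  have hsub : ∀ σ : Equiv.Perm V, permEdges Arc.edge σ⁻¹ ⊆ permEdges Arc.edge σ := by
    intro σ e he
    obtain ⟨v, rfl⟩ := mem_permEdges.1 he
    have hv : σ (σ⁻¹ v.1) ≠ σ⁻¹ v.1 := by
      rw [show σ (σ⁻¹ v.1) = v.1 from σ.apply_symm_apply v.1]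
      exact fun h => v.2 h.symm
    exact mem_permEdges.2 ⟨⟨σ⁻¹ v.1, hv⟩, edge_permArc_eq_iff.2 (Or.inr
      ⟨rfl, σ.apply_symm_apply v.1⟩)⟩
  refine (hsub σ).antisymm ?_
  simpa using hsub σ⁻¹

variable (V)

/-- The system of all cycles of the complete undirected graph. -/
noncomputable def undirectedSystem :
    CycleSystem V (Edge V) {σ : Equiv.Perm V // IsChosenCycle σ}
      fun k => if 3 ≤ k then 1 / (2 * k : ℝ) else 0 :=
  CycleSystem.ofPerms IsChosenCycle (fun _ h => h.1) Arc.edge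
    (fun a b h => congrArg Subtype.val h)
    (fun σ h => injective_edge_permArc h.1 h.2.1)
    (fun σ τ hσ hτ hne hnd => by
      by_contra! hcon
      have key : ∀ v ∈ σ.support ∩ τ.support, τ v = σ v ∨ τ v = σ⁻¹ v := by
        intro v hv
        obtain ⟨h1, h2⟩ := Finset.mem_inter.1 hv
        obtain ⟨u, hu⟩ := mem_permEdges.1 (hcon ⟨v, mem_support.1 h2⟩ h1)
        rcases edge_permArc_eq_iff.1 hu with ⟨e1, e2⟩ | ⟨e1, e2⟩
        · left
          rw [← e2, e1]
        · right
          rw [eq_inv_iff_eq]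
          exact (congrArg σ e1).symm.trans e2
      rcases eq_or_eq_inv_of_agree hσ.1 hτ.1 hτ.2.1 hnd key with h | h
      · exact hne h.symm
      · exact hσ.not_inv (h ▸ hτ))
    card_chosen_cycles

end Undirected

/-! ### Light cycles and light permutations -/

theorem apply_finRotate {α : Type*} {k : ℕ} (F : ℕ → α) (hF : F k = F 0) (i : Fin k) :
    F (finRotate k i) = F (i + 1) := by
  obtain ⟨m, rfl⟩ := Nat.exists_eq_succ_of_ne_zero i.pos.ne'
  rw [coe_finRotate]
  split_ifs with h
  · rw [h, Fin.val_last]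
    exact hF.symm
  · rfl

section Permutations

variable {V : Type*} [Fintype V] [DecidableEq V]

theorem exists_directedCycle_iff_exists_perm (w : Arc V → ℝ) (x : ℝ) (m : ℕ) :
    (∃ k, m ≤ k ∧ ∃ C : DirectedCycle V k, C.meanWeight w ≤ x) ↔
      ∃ σ : Equiv.Perm V, σ.IsCycle ∧ m ≤ σ.support.card ∧
        ∑ v, w (permArc σ v) ≤ σ.support.card * x := by
  constructor
  · rintro ⟨k, hm, C, hC⟩
    have hk := C.two_le
    have hk0 : (0 : ℝ) < k := by positivity
    let f : Fin k ↪ V := ⟨C.vertex, C.injective⟩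
    let σ : Equiv.Perm V := (finRotate k).viaFintypeEmbedding f
    have hσf : ∀ i, σ (C.vertex i) = C.vertex (finRotate k i) := fun i =>
      Equiv.Perm.viaFintypeEmbedding_apply_image (finRotate k) f i
    have hne : ∀ i, σ (C.vertex i) ≠ C.vertex i := fun i h =>
      finRotate_ne_self hk i (C.injective (by rw [← hσf, h]))
    have hbij : Function.Bijective
        fun i => (⟨C.vertex i, hne i⟩ : {v // σ v ≠ v}) := by
      refine ⟨fun i j h => C.injective (congrArg Subtype.val h), fun v => ?_⟩
      by_cases hv : v.1 ∈ Set.range f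
      · obtain ⟨i, hi⟩ := hv
        exact ⟨i, Subtype.ext hi⟩
      · exact absurd (Equiv.Perm.viaFintypeEmbedding_apply_notMem_range (finRotate k) f hv) v.2
    have hcard : σ.support.card = k := by
      rw [← card_subtype_apply_ne, ← Fintype.card_of_bijective hbij, Fintype.card_fin]
    refine ⟨σ, (isCycle_finRotate_of_le hk).extendDomain _, hcard ▸ hm, ?_⟩
    rw [DirectedCycle.meanWeight, div_le_iff₀ hk0] at hC
    rw [hcard, mul_comm]
    refine le_trans (le_of_eq ?_) hC
    refine (Fintype.sum_bijective _ hbij _ _ fun i => ?_).symm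
    congr 1
    exact Subtype.ext (Prod.ext rfl (hσf i).symm)
  · rintro ⟨σ, hσ, hm, hw⟩
    set k := σ.support.card with hk
    have hk2 : 2 ≤ k := hσ.two_le_card_support
    obtain ⟨v, hv, -⟩ := id hσ
    have hpow : (σ ^ k) v = v := by
      rw [hk, ← hσ.orderOf, pow_orderOf_eq_one, Equiv.Perm.one_apply]
    let C : DirectedCycle V k :=
      { two_le := hk2
        vertex := fun i => (σ ^ (i : ℕ)) v
        injective := fun i j h => by
          have h1 := (hσ.pow_eq_pow_iff (a := i) (b := j)).2 ⟨v, hv, h⟩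
          have h2 := pow_inj_mod.1 h1
          rw [hσ.orderOf, Nat.mod_eq_of_lt i.2, Nat.mod_eq_of_lt j.2] at h2
          exact Fin.ext h2 }
    have hCσ : ∀ i, C.vertex (finRotate k i) = σ (C.vertex i) := fun i => by
      refine (apply_finRotate (fun i => (σ ^ i) v) (by simpa using hpow) i).trans ?_
      simp only [pow_succ', Equiv.Perm.mul_apply]
      rfl
    have hne : ∀ i, σ (C.vertex i) ≠ C.vertex i := fun i h =>
      finRotate_ne_self hk2 i (C.injective (by rw [hCσ, h]))
    have hbij : Function.Bijective
        fun i => (⟨C.vertex i, hne i⟩ : {v // σ v ≠ v}) := by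
      rw [Fintype.bijective_iff_injective_and_card]
      refine ⟨fun i j h => C.injective (congrArg Subtype.val h), ?_⟩
      rw [card_subtype_apply_ne, Fintype.card_fin]
    refine ⟨k, hm, C, ?_⟩
    rw [DirectedCycle.meanWeight, div_le_iff₀ (by positivity : (0 : ℝ) < k), mul_comm]
    refine le_trans (le_of_eq ?_) hw
    refine Fintype.sum_bijective _ hbij _ _ fun i => ?_
    congr 1
    exact Subtype.ext (Prod.ext rfl (hCσ i))

theorem hasLightDirectedCycle_iff (w : Arc V → ℝ) (x : ℝ) :
    HasLightDirectedCycle w x ↔ ∃ a, w ∈ (directedSystem V).light x a := by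
  have h0 := exists_directedCycle_iff_exists_perm w x 0
  simp only [zero_le, true_and] at h0
  rw [HasLightDirectedCycle, h0, Subtype.exists]
  refine exists_congr fun σ => ?_
  have hsum : ∑ e ∈ permEdges id σ, w e = ∑ v, w (permArc σ v) :=
    Finset.sum_image fun u _ v _ h => Subtype.ext (congrArg (fun a : Arc V => a.1.1) h)
  rw [← hsum]
  exact ⟨fun h => ⟨h.1, h.2⟩, fun ⟨h1, h2⟩ => ⟨h1, h2⟩⟩

end Permutations

/-! ### Cycles in the complete undirected graph -/

section Walks

variable {V : Type*}

theorem exists_walk_getVert (m : ℕ) : ∀ (f : ℕ → V), (∀ i < m, f i ≠ f (i + 1)) →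
    ∃ p : (⊤ : SimpleGraph V).Walk (f 0) (f m), p.length = m ∧ ∀ i ≤ m, p.getVert i = f i := by
  induction m with
  | zero => exact fun f _ => ⟨.nil, rfl, fun i hi => by simp [Nat.le_zero.1 hi]⟩
  | succ m ih =>
    intro f hf
    obtain ⟨p, hp, hv⟩ := ih (fun i => f (i + 1)) fun i hi => hf (i + 1) (by omega)
    refine ⟨.cons (by simpa using hf 0 (by omega)) p, by simp [hp], fun i hi => ?_⟩
    cases i with
    | zero => simp
    | succ i => simpa using hv i (by omega)

theorem sum_map_edges_eq_sum_range (w : Sym2 V → ℝ) {G : SimpleGraph V} {u v : V}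
    (p : G.Walk u v) : (p.edges.map w).sum =
      ∑ i ∈ Finset.range p.length, w s(p.getVert i, p.getVert (i + 1)) := by
  induction p with
  | nil => simp
  | cons h p ih =>
    rw [SimpleGraph.Walk.length_cons, Finset.sum_range_succ', SimpleGraph.Walk.edges_cons,
      List.map_cons, List.sum_cons, ih, add_comm]
    simp

open Classical in
/-- The extension by zero of an edge weight to all unordered pairs. -/
noncomputable def extendWeight (w : Edge V → ℝ) (e : Sym2 V) : ℝ :=
  if h : e ∈ (⊤ : SimpleGraph V).edgeSet then w ⟨e, h⟩ else 0

theorem extendWeight_coe (w : Edge V → ℝ) (e : Edge V) : extendWeight w e = w e := by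
  simp only [extendWeight, dif_pos e.2]

theorem walkMeanWeight_eq (w : Edge V → ℝ) {u v : V} (p : (⊤ : SimpleGraph V).Walk u v) :
    walkMeanWeight w p =
      (∑ i ∈ Finset.range p.length, extendWeight w s(p.getVert i, p.getVert (i + 1))) /
        p.length := by
  rw [walkMeanWeight, ← sum_map_edges_eq_sum_range]
  congr 2
  conv_rhs => rw [← List.attach_map_subtype_val p.edges, List.map_map]
  refine List.map_congr_left fun e _ => ?_
  exact (extendWeight_coe w ⟨e.1, p.edges_subset_edgeSet e.2⟩).symm

theorem DirectedCycle.sum_edge_eq {k : ℕ} (C : DirectedCycle V k) (w : Edge V → ℝ) (F : ℕ → V)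
    (hF : ∀ i : Fin k, C.vertex i = F i) (hk : F k = F 0) :
    ∑ i, w (C.arc i).edge = ∑ i ∈ Finset.range k, extendWeight w s(F i, F (i + 1)) := by
  rw [Finset.sum_range]
  refine Finset.sum_congr rfl fun i _ => ?_
  rw [← extendWeight_coe w]
  change extendWeight w s(C.vertex i, C.vertex (finRotate k i)) = _
  rw [hF, hF, apply_finRotate F hk]

theorem hasLightCycle_iff_exists_directedCycle (w : Edge V → ℝ) (x : ℝ) :
    HasLightCycle w x ↔
      ∃ k, 3 ≤ k ∧ ∃ C : DirectedCycle V k, C.meanWeight (fun a => w a.edge) ≤ x := by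
  constructor
  · rintro ⟨u, p, hp, hw⟩
    have h3 := hp.three_le_length
    let C : DirectedCycle V p.length :=
      { two_le := by omega
        vertex := fun i => p.getVert i
        injective := fun i j h => Fin.ext (hp.getVert_injOn'
          (show (i : ℕ) ≤ p.length - 1 by omega) (show (j : ℕ) ≤ p.length - 1 by omega) h) }
    refine ⟨p.length, h3, C, ?_⟩
    rw [DirectedCycle.meanWeight, C.sum_edge_eq w p.getVert (fun i => rfl) (by simp),
      ← walkMeanWeight_eq]
    exact hw
  · rintro ⟨k, h3, C, hC⟩
    have hk0 : 0 < k := by omega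
    let F : ℕ → V := fun i => C.vertex ⟨i % k, Nat.mod_lt i hk0⟩
    have hFk : F k = F 0 := by simp [F]
    have hinj : ∀ i j, F i = F j → i % k = j % k := fun i j h =>
      congrArg Fin.val (C.injective h)
    obtain ⟨p, hp, hv⟩ := exists_walk_getVert k F fun i _ h => by
      have h1 := hinj _ _ h
      have h2 : i + 0 ≡ i + 1 [MOD k] := h1
      have h3' := (Nat.ModEq.add_left_cancel' i h2)
      rw [Nat.ModEq, Nat.zero_mod, Nat.mod_eq_of_lt (by omega)] at h3'
      omega
    let p' : (⊤ : SimpleGraph V).Walk (F 0) (F 0) := p.copy rfl hFk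
    have hp' : p'.length = k := by simp [p', hp]
    have hv' : ∀ i ≤ k, p'.getVert i = F i := fun i hi => by simpa [p'] using hv i hi
    refine ⟨F 0, p', ?_, ?_⟩
    · rw [SimpleGraph.Walk.isCycle_iff_isPath_tail_and_le_length, hp']
      refine ⟨?_, h3⟩
      have hnil : ¬p'.Nil := by
        rw [← SimpleGraph.Walk.length_eq_zero_iff]
        omega
      have hlen := SimpleGraph.Walk.length_tail_add_one hnil
      rw [← SimpleGraph.Walk.IsPath.getVert_injOn_iff]
      intro i hi j hj hij
      have hi' : i ≤ p'.tail.length := hi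
      have hj' : j ≤ p'.tail.length := hj
      rw [SimpleGraph.Walk.getVert_tail, SimpleGraph.Walk.getVert_tail, hv' _ (by omega),
        hv' _ (by omega)] at hij
      have h2 : i ≡ j [MOD k] := Nat.ModEq.add_right_cancel' 1 (hinj _ _ hij)
      rwa [Nat.ModEq, Nat.mod_eq_of_lt (by omega), Nat.mod_eq_of_lt (by omega)] at h2
    · rw [DirectedCycle.meanWeight, C.sum_edge_eq w F (fun i => by
        simp [F, Nat.mod_eq_of_lt i.2]) hFk] at hC
      rw [walkMeanWeight_eq, hp']
      refine le_trans (le_of_eq ?_) hC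
      congr 1
      refine Finset.sum_congr rfl fun i hi => ?_
      have := Finset.mem_range.1 hi
      rw [hv' i (by omega), hv' (i + 1) (by omega)]

theorem hasLightCycle_iff [Fintype V] [DecidableEq V] (w : Edge V → ℝ) (x : ℝ) :
    HasLightCycle w x ↔ ∃ a, w ∈ (undirectedSystem V).light x a := by
  have hsum : ∀ σ : Equiv.Perm V, σ.IsCycle → 3 ≤ σ.support.card →
      ∑ e ∈ permEdges Arc.edge σ, w e = ∑ v, w (permArc σ v).edge := fun σ h h3 =>
    Finset.sum_image fun u _ v _ h' => injective_edge_permArc h h3 h'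
  rw [hasLightCycle_iff_exists_directedCycle, exists_directedCycle_iff_exists_perm,
    Subtype.exists]
  constructor
  · rintro ⟨σ, hσ, h3, hw⟩
    rw [← hsum σ hσ h3] at hw
    rcases isChosenCycle_or_inv hσ h3 with h | h
    · exact ⟨σ, h, hw⟩
    · refine ⟨σ⁻¹, h, ?_⟩
      change ∑ e ∈ permEdges Arc.edge σ⁻¹, w e ≤ (σ⁻¹.support.card : ℝ) * x
      rwa [permEdges_edge_inv, Equiv.Perm.support_inv]
  · rintro ⟨σ, hσ, hw⟩
    refine ⟨σ, hσ.1, hσ.2.1, ?_⟩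
    rw [← hsum σ hσ.1 hσ.2.1]
    exact hw

end Walks

/-! ### The tree function -/

/-- The terms of the series of the tree function. -/
noncomputable def treeTerm (z : ℝ) (k : ℕ) : ℝ :=
  ((k + 1 : ℕ) : ℝ) ^ k * z ^ (k + 1) / ((k + 1).factorial : ℝ)

theorem not_summable_treeTerm {c : ℝ} (hc : 1 / Real.exp 1 < c) : ¬Summable (treeTerm c) := by
  have hc0 : 0 < c := (by positivity : (0 : ℝ) < 1 / Real.exp 1).trans hc
  have hl : 1 < c * Real.exp 1 := (div_lt_iff₀ (Real.exp_pos 1)).1 hc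
  refine not_summable_of_ratio_test_tendsto_gt_one hl ?_
  have h1 : Tendsto (fun k : ℕ => (1 + 1 / ((k + 1 : ℕ) : ℝ)) ^ (k + 1)) atTop
      (𝓝 (Real.exp 1)) := (Real.tendsto_one_add_div_pow_exp 1).comp (tendsto_add_atTop_nat 1)
  have h2 : Tendsto (fun k : ℕ => 1 + 1 / ((k + 1 : ℕ) : ℝ)) atTop (𝓝 1) := by
    simpa using ((tendsto_const_div_atTop_nhds_zero_nat (1 : ℝ)).comp
      (tendsto_add_atTop_nat 1)).const_add 1
  have h3 := (h1.div h2 one_ne_zero).const_mul c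
  rw [div_one] at h3
  refine h3.congr fun k => ?_
  have hpos : ∀ j, 0 < treeTerm c j := fun j => by unfold treeTerm; positivity
  rw [Real.norm_of_nonneg (hpos _).le, Real.norm_of_nonneg (hpos _).le]
  simp only [treeTerm, Pi.div_apply]
  rw [Nat.factorial_succ (k + 1), pow_succ (1 + 1 / ((k + 1 : ℕ) : ℝ)) k, mul_div_assoc,
    div_self (by positivity), mul_one]
  have hk : (1 : ℝ) + 1 / ((k + 1 : ℕ) : ℝ) = ((k + 1 + 1 : ℕ) : ℝ) / ((k + 1 : ℕ) : ℝ) := by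
    have : ((k + 1 : ℕ) : ℝ) ≠ 0 := by positivity
    field_simp
    push_cast
    ring
  rw [hk, div_pow, Nat.cast_mul]
  have ha : ((k + 1 : ℕ) : ℝ) ≠ 0 := by positivity
  have hb : ((k + 1 + 1 : ℕ) : ℝ) ≠ 0 := by positivity
  have hf : ((k + 1).factorial : ℝ) ≠ 0 := by positivity
  generalize ((k + 1 : ℕ) : ℝ) = a at *
  generalize ((k + 1 + 1 : ℕ) : ℝ) = b at *
  field_simp
  ring

/-- The mean numbers of light cycles of the various lengths, when `a * (n)_k / k` cycles have a given
length `k > m`. -/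
noncomputable def cycleTerm (m : ℕ) (a c : ℝ) (k : ℕ) : ℝ :=
  (if m + 1 ≤ k then a / (k : ℝ) else 0) * ((k : ℝ) ^ k * c ^ k / k.factorial)

theorem cycleTerm_add (m : ℕ) (a c : ℝ) (j : ℕ) :
    cycleTerm m a c (j + (m + 1)) = a * treeTerm c (j + m) := by
  rw [cycleTerm, if_pos (by omega), treeTerm, show j + (m + 1) = j + m + 1 by ring,
    pow_succ ((j + m + 1 : ℕ) : ℝ) (j + m)]
  have : ((j + m + 1 : ℕ) : ℝ) ≠ 0 := by positivity
  field_simp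

theorem summable_cycleTerm_iff (m : ℕ) {a : ℝ} (ha : a ≠ 0) (c : ℝ) :
    Summable (cycleTerm m a c) ↔ Summable (treeTerm c) := by
  rw [← summable_nat_add_iff (m + 1), ← summable_nat_add_iff (f := treeTerm c) m]
  simp_rw [cycleTerm_add]
  exact summable_mul_left_iff ha

theorem tsum_cycleTerm (m : ℕ) {a : ℝ} (ha : a ≠ 0) {c : ℝ} (h : Summable (treeTerm c)) :
    ∑' k, cycleTerm m a c k = a * (treeFunction c - ∑ j ∈ Finset.range m, treeTerm c j) := by
  have h1 := ((summable_cycleTerm_iff m ha c).2 h).sum_add_tsum_nat_add (m + 1)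
  have h2 := h.sum_add_tsum_nat_add m
  have h0 : ∑ k ∈ Finset.range (m + 1), cycleTerm m a c k = 0 :=
    Finset.sum_eq_zero fun k hk => by
      rw [cycleTerm, if_neg (not_le.2 (Finset.mem_range.1 hk)), zero_mul]
  simp_rw [cycleTerm_add, tsum_mul_left] at h1
  rw [← h1, h0, zero_add, show treeFunction c = ∑' k, treeTerm c k from rfl, ← h2]
  ring

theorem continuousOn_treeFunction :
    ContinuousOn treeFunction (Set.Icc (-(1 / Real.exp 1)) (1 / Real.exp 1)) := by
  have he : 0 < 1 / Real.exp 1 := by positivity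
  refine continuousOn_tsum (u := treeTerm (1 / Real.exp 1)) (fun k => by fun_prop)
    (summable_treeFunction (abs_of_pos he).le) fun k z hz => ?_
  rw [treeTerm, norm_div, norm_mul, norm_pow, norm_pow, Real.norm_natCast, Real.norm_natCast,
    Real.norm_eq_abs]
  gcongr
  exact abs_le.2 hz

theorem jumpsToOneAt_of_eq {F G : ℝ → ℝ}
    (hF : ∀ c, F c = if c ≤ 1 / Real.exp 1 then 1 - Real.exp (G c) else 1)
    (hG : ContinuousOn G (Set.Icc (-(1 / Real.exp 1)) (1 / Real.exp 1))) :
    JumpsToOneAt F (1 / Real.exp 1) := by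
  set r := 1 / Real.exp 1 with hr
  have he : 0 < r := by positivity
  refine ⟨?_, ?_, ?_⟩
  · rw [hF, if_pos le_rfl]
    linarith [Real.exp_pos (G r)]
  · have hcont : ContinuousWithinAt (fun c => 1 - Real.exp (G c)) (Set.Ioo (-r) r) r :=
      ((continuousOn_const.sub hG.rexp) r ⟨by linarith, le_rfl⟩).mono Set.Ioo_subset_Icc_self
    have h : Tendsto (fun c => 1 - Real.exp (G c)) (𝓝[Set.Ioo (-r) r] r)
      (𝓝 (1 - Real.exp (G r))) := hcont
    rw [nhdsWithin_Ioo_eq_nhdsLT (by linarith)] at h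
    rw [hF r, if_pos le_rfl]
    refine h.congr' ?_
    filter_upwards [self_mem_nhdsWithin] with c hc
    rw [hF, if_pos (le_of_lt hc)]
  · refine tendsto_const_nhds.congr' ?_
    filter_upwards [self_mem_nhdsWithin] with c hc
    rw [hF, if_neg (not_le.2 hc)]

/-! ### The limiting probabilities -/

/-- The limit law for a sequence of cycle systems with `a * (n)_k / k` cycles of length `k > m`. -/
theorem tendsto_exists_light {E ι : ℕ → Type*} [∀ n, Fintype (E n)] [∀ n, DecidableEq (E n)]
    [∀ n, Fintype (ι n)] {ρ : ℕ → ℝ} (𝒞 : ∀ n, CycleSystem (Fin n) (E n) (ι n) ρ) (m : ℕ)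
    {a : ℝ} (ha : 0 < a) (hρ : ∀ k : ℕ, ρ k = if m + 1 ≤ k then a / (k : ℝ) else 0)
    {Ω : ℕ → Type*} [∀ n, MeasurableSpace (Ω n)] (P : ∀ n, Measure (Ω n))
    [∀ n, IsProbabilityMeasure (P n)] (W : ∀ n, E n → Ω n → ℝ) (hW : ∀ n, IsIIDExp (P n) (W n))
    {c : ℝ} (hc : 0 ≤ c) :
    Tendsto (fun n : ℕ => (P n).real {ω | ∃ b, (fun e => W n e ω) ∈ (𝒞 n).light (c / n) b})
      atTop (𝓝 (if c ≤ 1 / Real.exp 1 then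
        1 - Real.exp (-(a * (treeFunction c - ∑ j ∈ Finset.range m, treeTerm c j))) else 1)) := by
  have hmeas : ∀ n : ℕ, (P n).real {ω | ∃ b, (fun e => W n e ω) ∈ (𝒞 n).light (c / n) b} =
      1 - (expWeights (E n)).real {w | ∀ b, w ∉ (𝒞 n).light (c / n) b} := fun n => by
    have hlaw : HasLaw (fun ω e => W n e ω) (expWeights (E n)) (P n) :=
      (iIndepFun_iff_hasLaw_pi_pi (hW n).1).1 (hW n).2
    have hset : MeasurableSet {w | ∃ b, w ∈ (𝒞 n).light (c / n) b} := by
      rw [Set.ofPred_exists]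
      exact MeasurableSet.iUnion fun b => (𝒞 n).measurableSet_light _ b
    have hcompl : {w | ∀ b, w ∉ (𝒞 n).light (c / n) b} =
        {w | ∃ b, w ∈ (𝒞 n).light (c / n) b}ᶜ := by
      ext w
      simp
    rw [hlaw.measureReal_eq hset, hcompl, probReal_compl_eq_one_sub hset, sub_sub_cancel]
  have hρ0 : ∀ k, 0 ≤ ρ k := fun k => by
    rw [hρ]
    split_ifs <;> positivity
  have hterm : (fun k : ℕ => ρ k * ((k : ℝ) ^ k * c ^ k / k.factorial)) = cycleTerm m a c := by
    ext k
    rw [hρ, cycleTerm]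
  simp_rw [hmeas]
  split_ifs with h
  · have hs : Summable (treeTerm c) := summable_treeFunction (by rwa [abs_of_nonneg hc])
    have hlim := CycleSystem.tendsto_measure_no_light_of_summable 𝒞 hρ0 hc
      (by rw [hterm]; exact (summable_cycleTerm_iff m ha.ne' c).2 hs)
    rw [hterm, tsum_cycleTerm m ha.ne' hs] at hlim
    exact hlim.const_sub 1
  · have hlim := CycleSystem.tendsto_measure_no_light_of_not_summable 𝒞 hρ0 hc
      (by
        rw [hterm, summable_cycleTerm_iff m ha.ne' c]
        exact not_summable_treeTerm (not_le.1 h))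
    simpa using hlim.const_sub 1

theorem tendsto_directed {Ω : ℕ → Type*} [∀ n, MeasurableSpace (Ω n)] (P : ∀ n, Measure (Ω n))
    [∀ n, IsProbabilityMeasure (P n)] (W : ∀ n, Arc (Fin n) → Ω n → ℝ)
    (hW : ∀ n, IsIIDExp (P n) (W n)) {c : ℝ} (hc : 0 ≤ c) :
    Tendsto (fun n : ℕ => (P n).real {ω | HasLightDirectedCycle (fun a => W n a ω) (c / n)})
      atTop (𝓝 (directedLimit c)) := by
  have h := tendsto_exists_light (fun n => directedSystem (Fin n)) 1 one_pos
    (fun k => rfl) P W hW hc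
  simp_rw [← hasLightDirectedCycle_iff] at h
  convert! h using 2
  rw [directedLimit]
  congr 3
  simp only [Finset.sum_range_one, treeTerm]
  norm_num
  ring

theorem tendsto_undirected {Ω : ℕ → Type*} [∀ n, MeasurableSpace (Ω n)] (P : ∀ n, Measure (Ω n))
    [∀ n, IsProbabilityMeasure (P n)] (W : ∀ n, Edge (Fin n) → Ω n → ℝ)
    (hW : ∀ n, IsIIDExp (P n) (W n)) {c : ℝ} (hc : 0 ≤ c) :
    Tendsto (fun n : ℕ => (P n).real {ω | HasLightCycle (fun e => W n e ω) (c / n)})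
      atTop (𝓝 (undirectedLimit c)) := by
  have h := tendsto_exists_light (fun n => undirectedSystem (Fin n)) 2
    (by norm_num : (0 : ℝ) < 1 / 2) (fun k => by rw [div_div]) P W hW hc
  simp_rw [← hasLightCycle_iff] at h
  convert! h using 2
  rw [undirectedLimit]
  congr 3
  simp only [Finset.sum_range_succ, Finset.sum_range_zero, treeTerm]
  norm_num
  ring

end MinMeanCycle

theorem mainTheorem1 :
    (∀ (Ω : ℕ → Type*) [∀ n, MeasurableSpace (Ω n)] (P : ∀ n, Measure (Ω n))
        [∀ n, IsProbabilityMeasure (P n)] (W : ∀ n, MinMeanCycle.Arc (Fin n) → Ω n → ℝ),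
        (∀ n, MinMeanCycle.IsIIDExp (P n) (W n)) → ∀ c : ℝ, 0 ≤ c →
        Tendsto
          (fun n : ℕ =>
            (P n).real {ω | MinMeanCycle.HasLightDirectedCycle (fun a => W n a ω) (c / n)})
          atTop (𝓝 (MinMeanCycle.directedLimit c))) ∧
    (∀ (Ω : ℕ → Type*) [∀ n, MeasurableSpace (Ω n)] (P : ∀ n, Measure (Ω n))
        [∀ n, IsProbabilityMeasure (P n)] (W : ∀ n, MinMeanCycle.Edge (Fin n) → Ω n → ℝ),
        (∀ n, MinMeanCycle.IsIIDExp (P n) (W n)) → ∀ c : ℝ, 0 ≤ c →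
        Tendsto
          (fun n : ℕ =>
            (P n).real {ω | MinMeanCycle.HasLightCycle (fun e => W n e ω) (c / n)})
          atTop (𝓝 (MinMeanCycle.undirectedLimit c))) ∧
    MinMeanCycle.JumpsToOneAt MinMeanCycle.directedLimit (1 / Real.exp 1) ∧
    MinMeanCycle.JumpsToOneAt MinMeanCycle.undirectedLimit (1 / Real.exp 1) := by
  refine ⟨fun Ω _ P _ W hW c hc => MinMeanCycle.tendsto_directed P W hW hc,
    fun Ω _ P _ W hW c hc => MinMeanCycle.tendsto_undirected P W hW hc,
    MinMeanCycle.jumpsToOneAt_of_eq (fun _ => rfl) ?_,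
    MinMeanCycle.jumpsToOneAt_of_eq (fun _ => rfl) ?_⟩
  · exact MinMeanCycle.continuousOn_treeFunction.neg.add continuousOn_id
  · exact ((MinMeanCycle.continuousOn_treeFunction.neg.add continuousOn_id).add
      (continuousOn_id.pow 2)).div_const 2
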